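/- **Setting.** Let $S,k,n$ be positive integers, $\mathcal S=\{1,\dots,S\}$, and let $\Phi\in\mathbb R^{S\times k}$ have full column rank. Let $V\in\mathbb R^S$, $\sigma\ge 0$ and $\delta\in(0,1)$. Let $\nu$ be a probability distribution on $\mathcal S$ and put $y_i=V(s_i)+\eta_i$ for $i=1,\dots,n$, where the pairs $(s_i,\eta_i)$ are i.i.d., $s_i\sim\nu$, and given $s_i=x$ the noise $\eta_i$ has a law $\xi_x$ on $\mathbb R$ that has mean zero and is $\sigma$-sub-Gaussian: $\int e^{tu}\,d\xi_x(u)\le e^{\sigma^2t^2/2}$ for all $t\in\mathbb R$ and all $x\in\mathcal S$. (This includes i.i.d. noise that is independent of the states.) Let $\hat w\in\mathbb R^k$ be a least-squares estimator, that is, a minimizer of $\frac1n\sum_{i=1}^n\big((\Phi w)(s_i)-y_i\big)^2$ over $w\in\mathbb R^k$. For a matrix $A$ let $P_A$ be the orthogonal projector onto the column space of $A$ and $P_A^\perp=I-P_A$. Let $d_{\mathrm{eff}}(\Phi)=S\max_{1\le i\le S}\|P_\Phi e_i\|_2^2$, where $(e_i)$ is the standard basis of $\mathbb R^S$. Let $N=\mathrm{diag}(\nu_1,\dots,\nu_S)$,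 $\underline\nu=\min_i\nu_i$, and $\|v\|_{u}^2=\frac1S\sum_{i=1}^S v_i^2$. **Theorem.** 1. (General distribution.) Suppose that $\nu_i>0$ for all $i$, and that $$n\ \ge\ \frac{8\,d_{\mathrm{eff}}(\Phi)}{\underline\nu\,S}\,\log(6k/\delta).$$ Put $r=P^\perp_{N^{1/2}\Phi}N^{1/2}V$. With probability at least $1-\delta$, the excess risk $\mathcal E(\Phi\hat w)=\mathbb E_{s\sim\nu}\big((\Phi\hat w)(s)-V(s)\big)^2$ of every least-squares estimator $\hat w$ satisfies $$\mathcal E(\Phi\hat w)\le\|r\|_2^2+384\,\frac{d_{\mathrm{eff}}(\Phi)}{\underline\nu\,nS}\,\|r\|_2^2\log(3/\delta)+48\,\frac{\sigma^2}{n}\big[2k+3\log(3/\delta)\big]+\frac{64}{3}\,\frac{d_{\mathrm{eff}}(\Phi)}{\underline\nu\,n^2S}\,\|N^{-1/2}r\|_\infty^2\log^2(3/\delta).$$ 2. (Uniform distribution.) Suppose that $\nu$ is uniform on $\mathcal S$ and that $n\ge 8\,d_{\mathrm{eff}}(\Phi)\log(6k/\delta)$. Let $R(f)=\frac1S\sum_{x\in\mathcal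 S}\int\big(f(x)-V(x)-u\big)^2d\xi_x(u)$ be the population risk of $f:\mathcal S\to\mathbb R$, and put $c=\log(3/\delta)$. With probability at least $1-\delta$, every least-squares estimator $\hat w$ satisfies $$R(\Phi\hat w)-R(V)\le\|P_\Phi^\perp V\|_{u}^2+384\,c\,\frac{d_{\mathrm{eff}}(\Phi)}{n}\,\|P_\Phi^\perp V\|_{u}^2+48\,\sigma^2\,\frac{2k+3c}{n}+\frac{64}{3}\,\frac{d_{\mathrm{eff}}(\Phi)}{n^2}\,\|P_\Phi^\perp V\|_\infty^2\,c^2.$$ -/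

import Mathlib

open MeasureTheory ProbabilityTheory
open scoped NNReal ENNReal Matrix

namespace LinearRegression

noncomputable section

/-- The orthogonal projector `P_A` of `ℝ^S` onto the column space of `A`. -/
def colProj {S k : ℕ} (A : Matrix (Fin S) (Fin k) ℝ) :
    EuclideanSpace ℝ (Fin S) →L[ℝ] EuclideanSpace ℝ (Fin S) :=
  (LinearMap.range (Matrix.toEuclideanLin A)).starProjection

/-- `P_A^⊥ v = (I - P_A) v`. -/
def colProjPerp {S k : ℕ} (A : Matrix (Fin S) (Fin k) ℝ) (v : Fin S → ℝ) :
    EuclideanSpace ℝ (Fin S) :=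
  WithLp.toLp 2 v - colProj A (WithLp.toLp 2 v)

/-- The effective dimension `S * max_i ‖P_Φ e_i‖₂²`. -/
def effDim {S k : ℕ} (Φ : Matrix (Fin S) (Fin k) ℝ) : ℝ :=
  (S : ℝ) * ⨆ i : Fin S, ‖colProj Φ (EuclideanSpace.single i 1)‖ ^ 2

/-- The smallest point mass `min_i ν_i`. -/
def minMass {S : ℕ} (ν : Measure (Fin S)) : ℝ := ⨅ i : Fin S, ν.real {i}

/-- `N^{1/2}`, where `N = E_{i ∼ ν} [e_i e_iᵀ]` is the diagonal matrix with entries `ν_i`. -/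
def sqrtN {S : ℕ} (ν : Measure (Fin S)) : Matrix (Fin S) (Fin S) ℝ :=
  Matrix.diagonal fun i => √(ν.real {i})

/-- `N^{-1/2}`. -/
def invSqrtN {S : ℕ} (ν : Measure (Fin S)) : Matrix (Fin S) (Fin S) ℝ :=
  Matrix.diagonal fun i => (√(ν.real {i}))⁻¹

/-- The vector `P^⊥_{N^{1/2} Φ} N^{1/2} V`. -/
def weightedResidual {S k : ℕ} (ν : Measure (Fin S)) (Φ : Matrix (Fin S) (Fin k) ℝ)
    (V : Fin S → ℝ) : EuclideanSpace ℝ (Fin S) :=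
  colProjPerp (sqrtN ν * Φ) (sqrtN ν *ᵥ V)

/-- The uniformly weighted `L²` norm `√((1/S) * ∑ V(s)²)`. -/
def uniformNorm {S : ℕ} (V : Fin S → ℝ) : ℝ := √((1 / (S : ℝ)) * ∑ i, V i ^ 2)

/-- The supremum norm `max_i |v_i|` (the norm of the function type `Fin S → ℝ`). -/
def supNorm {S : ℕ} (v : Fin S → ℝ) : ℝ := ‖v‖

/-- The empirical risk `(1/n) * ∑ (V_{φ,w}(s_i) - y_i)²`, where `V_{φ,w} = Φ w`. -/
def empiricalRisk {S k n : ℕ} (Φ : Matrix (Fin S) (Fin k) ℝ) (s : Fin n → Fin S)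
    (y : Fin n → ℝ) (w : Fin k → ℝ) : ℝ :=
  (1 / (n : ℝ)) * ∑ i, ((Φ *ᵥ w) (s i) - y i) ^ 2

/-- `w` is a least-squares estimator: a global minimizer of the empirical risk. -/
def IsLeastSquares {S k n : ℕ} (Φ : Matrix (Fin S) (Fin k) ℝ) (s : Fin n → Fin S)
    (y : Fin n → ℝ) (w : Fin k → ℝ) : Prop :=
  ∀ w' : Fin k → ℝ, empiricalRisk Φ s y w ≤ empiricalRisk Φ s y w'

/-- The population risk `E (f(s) - y)²` of `f`, where `s ∼ ν`, `y = V(s) + e` and, given `s`,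
the noise `e` has law `ξ s`. -/
def populationRisk {S : ℕ} (ν : Measure (Fin S)) (ξ : Kernel (Fin S) ℝ) (V f : Fin S → ℝ) : ℝ :=
  ∫ x, (∫ e, (f x - (V x + e)) ^ 2 ∂(ξ x)) ∂ν

/-- The excess risk `E_{s ∼ ν} (f(s) - V(s))²`. -/
def excessRisk {S : ℕ} (ν : Measure (Fin S)) (V f : Fin S → ℝ) : ℝ :=
  ∫ x, (f x - V x) ^ 2 ∂ν

/-- The uniform distribution on the states. -/
def uniformStates (S : ℕ) : Measure (Fin S) := uniformOn Set.univ

end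

end LinearRegression

open LinearRegression

/-! In an orthonormal basis of the column space of `N^{1/2} Φ`, the regression has features `φ x` in
`ℝ^k` that are isotropic (`E φ φᵀ = 1`) and satisfy `‖φ x‖² ≤ L = d_eff / (ν_min S)`. With `g =
N^{-1/2} r`, every `Φ w - V` equals `⟪φ, θ⟫ - g` for some `θ`. Since `g` is `ν`-orthogonal to the
features, the excess risk is exactly `‖r‖² + ‖θ‖²`, so only `‖θ‖²` has to be bounded.

For a least-squares `w` the normal equations read `G θ = ∑ g(s_i) φ(s_i) + ∑ η_i φ(s_i)`, where `G =
∑ φ(s_i) φ(s_i)ᵀ`. Three events control `θ`: `G ≥ n/2` fails with probability at most `δ/6`, by a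
matrix Chernoff bound resting on Golden–Thompson (`Matrix.sum_pi_prod_le_of_small_eigenvalue`); the
centred bias sum is too large with probability at most `δ/2`, by a dimension-free Bernstein
inequality (`sum_pi_prod_le_of_lt_norm_sum_sq`); given the states, the noise term is too large with
probability at most `δ/3`, by Gaussian linearization (`measure_lt_norm_sq_le`).

The state space is finite, so conditioning on the states is a finite sum over slices, and the first
two events are weighted sums over state sequences (`measure_pi_exists_normal_equation_le`). -/

/-! ### The Lie product formula. -/

theorem norm_exp_le_exp_norm_of_normedAlgebra {𝔸 : Type*} [NormedRing 𝔸] [NormOneClass 𝔸]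
    [NormedAlgebra ℝ 𝔸] [CompleteSpace 𝔸] (x : 𝔸) :
    ‖NormedSpace.exp x‖ ≤ Real.exp ‖x‖ := by
  have h1 := NormedSpace.exp_series_hasSum_exp' (𝕂 := ℝ) x
  have h2 := NormedSpace.exp_series_hasSum_exp' (𝕂 := ℝ) ‖x‖
  rw [← Real.exp_eq_exp_ℝ] at h2
  rw [← h1.tsum_eq, ← h2.tsum_eq]
  refine tsum_of_norm_bounded h2.summable.hasSum fun i => ?_
  rw [norm_smul, Real.norm_of_nonneg (by positivity), smul_eq_mul]
  gcongr
  exact norm_pow_le x i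

/-- Telescoping of noncommutative powers; `1 ≤ K` allows `K ^ N` in place of the sharper `K ^ (N -
1)`. -/
theorem norm_pow_sub_pow_le_of_norm_le {𝔸 : Type*} [NormedRing 𝔸] [NormOneClass 𝔸]
    {P Q : 𝔸} {K : ℝ} (hK : 1 ≤ K) (hP : ‖P‖ ≤ K) (hQ : ‖Q‖ ≤ K) (N : ℕ) :
    ‖P ^ N - Q ^ N‖ ≤ N * K ^ N * ‖P - Q‖ := by
  induction N with
  | zero => simp
  | succ N ih =>
    have h : P ^ (N + 1) - Q ^ (N + 1) = P ^ N * (P - Q) + (P ^ N - Q ^ N) * Q := by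
      rw [pow_succ, pow_succ]; noncomm_ring
    have hPN : ‖P ^ N‖ ≤ K ^ N := (norm_pow_le P N).trans (by gcongr)
    calc ‖P ^ (N + 1) - Q ^ (N + 1)‖
        ≤ ‖P ^ N‖ * ‖P - Q‖ + ‖P ^ N - Q ^ N‖ * ‖Q‖ := by
          rw [h]
          exact (norm_add_le _ _).trans (add_le_add (norm_mul_le _ _) (norm_mul_le _ _))
      _ ≤ K ^ N * ‖P - Q‖ + (N * K ^ N * ‖P - Q‖) * K := by gcongr
      _ ≤ K ^ (N + 1) * ‖P - Q‖ + (N * K ^ N * ‖P - Q‖) * K := by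
          gcongr
          simp
      _ = (N + 1 : ℕ) * K ^ (N + 1) * ‖P - Q‖ := by push_cast; ring

open Filter Topology in
/-- The Lie product formula. -/
theorem tendsto_exp_mul_exp_pow {𝔸 : Type*} [NormedRing 𝔸] [NormOneClass 𝔸]
    [NormedAlgebra ℝ 𝔸] [CompleteSpace 𝔸] (A B : 𝔸) :
    Tendsto (fun N : ℕ => (NormedSpace.exp ((N : ℝ)⁻¹ • A) * NormedSpace.exp ((N : ℝ)⁻¹ • B)) ^ N)
      atTop (𝓝 (NormedSpace.exp (A + B))) := by
  have hexp (C : 𝔸) := hasDerivAt_exp_smul_const (𝕂 := ℝ) C (0 : ℝ)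
  -- Both terms have derivative `A + B` at `0`, so at `t = 1/N` they differ by `o(1/N)`; taking
  -- `N`-th powers amplifies this by at most `N * K`.
  have hf : HasDerivAt (fun t : ℝ => NormedSpace.exp (t • A) * NormedSpace.exp (t • B)
      - NormedSpace.exp (t • (A + B))) 0 0 := by
    refine (((hexp A).mul (hexp B)).sub (hexp (A + B))).congr_deriv ?_
    simp only [zero_smul, NormedSpace.exp_zero, one_mul, mul_one]
    abel
  have hN : Tendsto (fun N : ℕ => ((N : ℝ))⁻¹) atTop (𝓝[≠] 0) :=
    (tendsto_inv_atTop_nhdsGT_zero.comp tendsto_natCast_atTop_atTop).mono_right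
      (nhdsWithin_mono _ fun x hx => ne_of_gt hx)
  have hlim := (hf.tendsto_slope_zero.comp hN).norm
  set K := Real.exp (‖A‖ + ‖B‖) with hKdef
  rw [tendsto_iff_norm_sub_tendsto_zero]
  have hlim2 := hlim.const_mul K
  simp only [norm_zero, mul_zero] at hlim2
  refine squeeze_zero' (Eventually.of_forall fun _ => norm_nonneg _) ?_ hlim2
  filter_upwards [eventually_gt_atTop 0] with N hNpos
  have hNR : (0 : ℝ) < N := by exact_mod_cast hNpos
  set k := Real.exp ((‖A‖ + ‖B‖) / N)
  have hQ : NormedSpace.exp (A + B) = (NormedSpace.exp ((N : ℝ)⁻¹ • (A + B))) ^ N := by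
    have hA := NormedAlgebra.restrictScalars ℚ ℝ 𝔸
    rw [← NormedSpace.exp_nsmul, ← Nat.cast_smul_eq_nsmul ℝ, smul_smul, mul_inv_cancel₀ hNR.ne',
      one_smul]
  have hk : k ^ N = K := by
    rw [← Real.exp_nat_mul, hKdef]
    congr 1
    field_simp
  have hns (C : 𝔸) : ‖(N : ℝ)⁻¹ • C‖ = ‖C‖ / N := by
    rw [norm_smul, Real.norm_of_nonneg (by positivity)]; ring
  have hP1 : ‖NormedSpace.exp ((N : ℝ)⁻¹ • A) * NormedSpace.exp ((N : ℝ)⁻¹ • B)‖ ≤ k := by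
    refine (norm_mul_le _ _).trans ?_
    rw [show k = Real.exp (‖A‖ / N) * Real.exp (‖B‖ / N) by
      rw [← Real.exp_add, ← add_div],
      ← hns, ← hns]
    exact mul_le_mul (norm_exp_le_exp_norm_of_normedAlgebra _)
      (norm_exp_le_exp_norm_of_normedAlgebra _) (norm_nonneg _) (Real.exp_nonneg _)
  have hQ1 : ‖NormedSpace.exp ((N : ℝ)⁻¹ • (A + B))‖ ≤ k := by
    refine (norm_exp_le_exp_norm_of_normedAlgebra _).trans ?_
    rw [hns]
    exact Real.exp_le_exp.2 (div_le_div_of_nonneg_right (norm_add_le _ _) hNR.le)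
  rw [hQ]
  refine (norm_pow_sub_pow_le_of_norm_le (Real.one_le_exp (by positivity)) hP1 hQ1 N).trans
    (le_of_eq ?_)
  simp only [Function.comp, inv_inv, zero_add, zero_smul, NormedSpace.exp_zero, mul_one, sub_self,
    sub_zero, norm_smul]
  rw [hk, Real.norm_of_nonneg hNR.le]
  ring

/-! ### The Golden–Thompson inequality. -/

namespace Matrix

variable {m : Type*} [Fintype m] [DecidableEq m]

theorem trace_mul_pow_comm (A B : Matrix m m ℝ) (q : ℕ) :
    ((A * B) ^ q).trace = ((B * A) ^ q).trace := by
  cases q with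
  | zero => simp
  | succ q =>
    rw [pow_succ', mul_assoc, trace_mul_comm, (show SemiconjBy B (A * B) (B * A) from
      (mul_assoc B A B).symm).pow_right q |>.eq, mul_assoc, ← pow_succ]

omit [DecidableEq m] in
theorem sum_sq_eq_trace (A : Matrix m m ℝ) : ∑ p : m × m, A p.1 p.2 ^ 2 = (A * Aᵀ).trace := by
  simp [trace, mul_apply, Fintype.sum_prod_type, sq]

omit [DecidableEq m] in
theorem trace_mul_transpose_le_sqrt (A B : Matrix m m ℝ) :
    (A * Bᵀ).trace ≤ √((A * Aᵀ).trace) * √((B * Bᵀ).trace) := by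
  rw [← sum_sq_eq_trace, ← sum_sq_eq_trace]
  refine le_trans (le_of_eq ?_)
    (Real.sum_mul_le_sqrt_mul_sqrt Finset.univ (fun p : m × m => A p.1 p.2) fun p => B p.1 p.2)
  simp [trace, mul_apply, Fintype.sum_prod_type]

/-- The two families are proved together: at level `i + 1` each uses both at level `i`. At level `0`
both are Cauchy–Schwarz for the Frobenius inner product; beyond that only cyclicity of the trace is
needed. Dyadic exponents suffice for the limit in the Lie formula. -/
theorem trace_pow_le_of_two_pow (i : ℕ) :
    (∀ A B : Matrix m m ℝ, A.IsSymm → B.IsSymm →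
      ((A * B) ^ 2 ^ i).trace ≤ √((A ^ 2 ^ (i + 1)).trace) * √((B ^ 2 ^ (i + 1)).trace)) ∧
    ∀ M : Matrix m m ℝ, (M ^ 2 ^ (i + 1)).trace ≤ ((M * Mᵀ) ^ 2 ^ i).trace := by
  induction i with
  | zero =>
    have h1 (M : Matrix m m ℝ) : 0 ≤ (M * Mᵀ).trace := by
      rw [← sum_sq_eq_trace]; positivity
    constructor
    · intro A B hA hB
      have := trace_mul_transpose_le_sqrt A B
      rw [hA.eq, hB.eq] at this
      simpa [sq] using this
    · intro M
      have := trace_mul_transpose_le_sqrt M Mᵀ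
      rw [transpose_transpose, trace_mul_comm Mᵀ, Real.mul_self_sqrt (h1 M)] at this
      simpa [sq] using this
  | succ i ih =>
    obtain ⟨ha, hb⟩ := ih
    have key (X Y : Matrix m m ℝ) (hX : X.IsSymm) (hY : Y.IsSymm) :
        ((X * Y) ^ 2 ^ (i + 1)).trace ≤ ((X ^ 2 * Y ^ 2) ^ 2 ^ i).trace := by
      refine (hb (X * Y)).trans (le_of_eq ?_)
      rw [transpose_mul, hX.eq, hY.eq, show X * Y * (Y * X) = (X * Y ^ 2) * X by
        simp only [sq, mul_assoc], trace_mul_pow_comm]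
      simp only [sq, mul_assoc]
    constructor
    · intro A B hA hB
      refine (key A B hA hB).trans ((ha _ _ (hA.pow 2) (hB.pow 2)).trans (le_of_eq ?_))
      simp only [← pow_mul, ← pow_succ']
    · intro M
      have h1 : (M * Mᵀ).IsSymm := by simp [IsSymm]
      have h2 : (Mᵀ * M).IsSymm := by simp [IsSymm]
      have h3 : 0 ≤ ((M * Mᵀ) ^ 2 ^ (i + 1)).trace := by
        have : (M * Mᵀ) ^ 2 ^ (i + 1) = (M * Mᵀ) ^ 2 ^ i * ((M * Mᵀ) ^ 2 ^ i)ᵀ := by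
          rw [(h1.pow _).eq, ← pow_add]; ring_nf
        rw [this, ← sum_sq_eq_trace]; positivity
      calc (M ^ 2 ^ (i + 1 + 1)).trace = ((M ^ 2) ^ 2 ^ (i + 1)).trace := by
            rw [← pow_mul, ← pow_succ']
        _ ≤ ((M ^ 2 * (M ^ 2)ᵀ) ^ 2 ^ i).trace := hb _
        _ = (((Mᵀ * M) * (M * Mᵀ)) ^ 2 ^ i).trace := by
            rw [sq, transpose_mul, show M * M * (Mᵀ * Mᵀ) = M * (M * Mᵀ * Mᵀ) by
              simp only [mul_assoc], trace_mul_pow_comm, show M * Mᵀ * Mᵀ * M = M * Mᵀ * (Mᵀ * M) by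
              simp only [mul_assoc], trace_mul_pow_comm]
        _ ≤ _ := ha _ _ h2 h1
        _ = ((M * Mᵀ) ^ 2 ^ (i + 1)).trace := by
            rw [trace_mul_pow_comm Mᵀ, Real.mul_self_sqrt h3]

theorem trace_mul_pow_two_pow_le (i : ℕ) : ∀ A B : Matrix m m ℝ, A.IsSymm → B.IsSymm →
    ((A * B) ^ 2 ^ i).trace ≤ (A ^ 2 ^ i * B ^ 2 ^ i).trace := by
  induction i with
  | zero => simp
  | succ i ih =>
    intro A B hA hB
    calc ((A * B) ^ 2 ^ (i + 1)).trace ≤ ((A * B * (A * B)ᵀ) ^ 2 ^ i).trace :=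
          (trace_pow_le_of_two_pow i).2 _
      _ = ((A ^ 2 * B ^ 2) ^ 2 ^ i).trace := by
          rw [transpose_mul, hA.eq, hB.eq, show A * B * (B * A) = (A * B ^ 2) * A by
            simp only [sq, mul_assoc], trace_mul_pow_comm]
          simp only [sq, mul_assoc]
      _ ≤ ((A ^ 2) ^ 2 ^ i * (B ^ 2) ^ 2 ^ i).trace := ih _ _ (hA.pow 2) (hB.pow 2)
      _ = _ := by simp only [← pow_mul, ← pow_succ']

open Filter Topology in
/-- The **Golden–Thompson inequality** for real symmetric matrices. -/
theorem trace_exp_add_le {A B : Matrix m m ℝ} (hA : A.IsSymm) (hB : B.IsSymm) :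
    (NormedSpace.exp (A + B)).trace ≤ (NormedSpace.exp A * NormedSpace.exp B).trace := by
  cases isEmpty_or_nonempty m
  · simp [trace]
  let _ : NormedRing (Matrix m m ℝ) := Matrix.linftyOpNormedRing
  let _ : NormedAlgebra ℝ (Matrix m m ℝ) := Matrix.linftyOpNormedAlgebra
  have : NormOneClass (Matrix m m ℝ) := Matrix.linfty_opNormOneClass
  have hcont : Continuous (fun M : Matrix m m ℝ => M.trace) := by
    unfold trace; fun_prop
  have hlim : Tendsto (fun i : ℕ => ((NormedSpace.exp (((2 ^ i : ℕ) : ℝ)⁻¹ • A)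
      * NormedSpace.exp (((2 ^ i : ℕ) : ℝ)⁻¹ • B)) ^ 2 ^ i).trace) atTop
      (𝓝 (NormedSpace.exp (A + B)).trace) :=
    (hcont.tendsto _).comp ((tendsto_exp_mul_exp_pow A B).comp
      (tendsto_pow_atTop_atTop_of_one_lt one_lt_two))
  refine le_of_tendsto hlim (Eventually.of_forall fun i => ?_)
  refine (trace_mul_pow_two_pow_le i _ _ (hA.smul _).exp (hB.smul _).exp).trans (le_of_eq ?_)
  have h2 : ((2 ^ i : ℕ) : ℝ) ≠ 0 := by positivity
  rw [← exp_nsmul, ← exp_nsmul, ← Nat.cast_smul_eq_nsmul ℝ, ← Nat.cast_smul_eq_nsmul ℝ, smul_smul,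
    smul_smul, mul_inv_cancel₀ h2, one_smul, one_smul]

end Matrix

/-! ### Iterated exponential moments and the matrix Chernoff bound. -/

/-- Iterating a one-step contraction in expectation along independent increments on a finite
state space. -/
theorem sum_pi_prod_mul_le_pow_mul {ι M : Type*} [Fintype ι] [AddCommMonoid M] (w : ι → ℝ)
    (hw : ∀ x, 0 ≤ w x) (Y : ι → M) (p : M → Prop) (hp : ∀ A x, p A → p (A + Y x)) (F : M → ℝ)
    {q : ℝ} (hq : 0 ≤ q) (hF : ∀ A, p A → ∑ x, w x * F (A + Y x) ≤ q * F A) (n : ℕ) :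
    ∀ A, p A → ∑ x : Fin n → ι, (∏ i, w (x i)) * F (A + ∑ i, Y (x i)) ≤ q ^ n * F A := by
  induction n with
  | zero => intro A _; simp
  | succ n ih =>
    intro A hA
    rw [← (Fin.consEquiv fun _ : Fin (n + 1) => ι).sum_comp, Fintype.sum_prod_type]
    calc ∑ a : ι, ∑ x : Fin n → ι, (∏ i, w ((Fin.consEquiv fun _ : Fin (n + 1) => ι) (a, x) i)) *
          F (A + ∑ i, Y ((Fin.consEquiv fun _ : Fin (n + 1) => ι) (a, x) i))
        = ∑ a, w a * ∑ x : Fin n → ι, (∏ i, w (x i)) * F (A + Y a + ∑ i, Y (x i)) := by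
          refine Finset.sum_congr rfl fun a _ => ?_
          rw [Finset.mul_sum]
          refine Finset.sum_congr rfl fun x _ => ?_
          simp [Fin.consEquiv, Fin.prod_univ_succ, Fin.sum_univ_succ, mul_assoc, add_assoc]
      _ ≤ ∑ a, w a * (q ^ n * F (A + Y a)) := by
          refine Finset.sum_le_sum fun a _ => mul_le_mul_of_nonneg_left (ih _ (hp A a hA)) (hw a)
      _ = q ^ n * ∑ a, w a * F (A + Y a) := by
          rw [Finset.mul_sum]; exact Finset.sum_congr rfl fun a _ => by ring
      _ ≤ q ^ n * (q * F A) := mul_le_mul_of_nonneg_left (hF A hA) (by positivity)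
      _ = q ^ (n + 1) * F A := by ring

namespace Matrix

variable {m : Type*} [Fintype m] [DecidableEq m]

theorem exp_smul_of_mul_self_eq_smul {X : Matrix m m ℝ} {b : ℝ} (hb : b ≠ 0)
    (hX : X * X = b • X) (t : ℝ) :
    NormedSpace.exp (t • X) = 1 + ((Real.exp (t * b) - 1) / b) • X := by
  cases isEmpty_or_nonempty m
  · exact Subsingleton.elim _ _
  let _ : NormedRing (Matrix m m ℝ) := Matrix.linftyOpNormedRing
  let _ : NormedAlgebra ℝ (Matrix m m ℝ) := Matrix.linftyOpNormedAlgebra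
  have hpow (n : ℕ) : X ^ (n + 1) = b ^ n • X := by
    induction n with
    | zero => simp
    | succ n ih => rw [pow_succ, ih, smul_mul_assoc, hX, smul_smul, ← pow_succ]
  have h1 := NormedSpace.exp_series_hasSum_exp' (𝕂 := ℝ) (t • X)
  have h2 := NormedSpace.exp_series_hasSum_exp' (𝕂 := ℝ) (t * b)
  rw [← Real.exp_eq_exp_ℝ] at h2
  -- The scalar series times `b⁻¹ • X` matches the matrix series except at index `0`, where it gives
  -- `b⁻¹ • X` instead of `1`; the added term corrects this.
  have h3 := (h2.smul_const (b⁻¹ • X)).add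
    (hasSum_ite_eq (0 : ℕ) (1 - b⁻¹ • X : Matrix m m ℝ))
  refine (h1.unique (h3.congr_fun ?_)).trans ?_
  · intro n
    cases n with
    | zero => simp
    | succ n =>
      simp only [smul_pow, hpow, smul_eq_mul, Nat.add_eq_zero_iff, one_ne_zero, and_false, if_false,
        add_zero, smul_smul]
      congr 1
      rw [mul_pow, pow_succ b]
      field_simp
  · rw [smul_smul, sub_div, sub_smul, ← div_eq_mul_inv, one_div]
    abel

theorem trace_exp_eq_sum {A : Matrix m m ℝ} (hA : A.IsHermitian) :
    (NormedSpace.exp A).trace = ∑ i, Real.exp (hA.eigenvalues i) := by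
  conv_lhs => rw [hA.spectral_theorem, Unitary.conjStarAlgAut_apply]
  have := exp_units_conj (Unitary.toUnits hA.eigenvectorUnitary)
    (diagonal (RCLike.ofReal ∘ hA.eigenvalues : m → ℝ))
  have h2 : (↑(Unitary.toUnits hA.eigenvectorUnitary)⁻¹ : Matrix m m ℝ)
    = star (hA.eigenvectorUnitary : Matrix m m ℝ) := rfl
  rw [h2, Unitary.val_toUnits_apply] at this
  rw [this, mul_assoc, trace_mul_comm, mul_assoc, Unitary.coe_star_mul_self, mul_one, exp_diagonal,
    trace_diagonal]
  refine Finset.sum_congr rfl fun i _ => ?_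
  rw [Pi.coe_exp, Real.exp_eq_exp_ℝ]
  rfl

/-- A Rayleigh quotient above `a` forces an eigenvalue above `a`, and every eigenvalue contributes a
positive term to the trace of the exponential. -/
theorem exp_le_trace_exp {A : Matrix m m ℝ} (hA : A.IsSymm) {a : ℝ} {z : m → ℝ}
    (hz : a * (z ⬝ᵥ z) < z ⬝ᵥ A *ᵥ z) : Real.exp a ≤ (NormedSpace.exp A).trace := by
  have hA' : A.IsHermitian := by rwa [IsHermitian, conjTranspose_eq_transpose_of_trivial]
  rw [trace_exp_eq_sum hA']
  obtain ⟨i, hi⟩ : ∃ i, a < hA'.eigenvalues i := by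
    by_contra! h
    refine absurd hz (not_lt.2 ?_)
    set U : Matrix m m ℝ := hA'.eigenvectorUnitary.1
    have hU : U * Uᵀ = 1 := by
      have := Unitary.coe_mul_star_self hA'.eigenvectorUnitary
      rwa [Unitary.coe_star, star_eq_conjTranspose, conjTranspose_eq_transpose_of_trivial] at this
    have hsp : A = U * diagonal hA'.eigenvalues * Uᵀ := by
      conv_lhs => rw [hA'.spectral_theorem, Unitary.conjStarAlgAut_apply, star_eq_conjTranspose,
        conjTranspose_eq_transpose_of_trivial]
      rfl
    have h1 : z ⬝ᵥ A *ᵥ z = (Uᵀ *ᵥ z) ⬝ᵥ (diagonal hA'.eigenvalues *ᵥ (Uᵀ *ᵥ z)) := by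
      conv_lhs => rw [hsp, ← mulVec_mulVec, ← mulVec_mulVec, dotProduct_mulVec, ← mulVec_transpose]
    have h2 : z ⬝ᵥ z = (Uᵀ *ᵥ z) ⬝ᵥ (Uᵀ *ᵥ z) := by
      rw [dotProduct_mulVec, ← mulVec_transpose, transpose_transpose, mulVec_mulVec, hU, one_mulVec]
    rw [h1, h2]
    simp only [dotProduct, mulVec_diagonal, Finset.mul_sum]
    refine Finset.sum_le_sum fun j _ => ?_
    nlinarith [mul_self_nonneg ((Uᵀ *ᵥ z) j), h j]
  exact (Real.exp_le_exp.2 hi.le).trans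
    (Finset.single_le_sum (f := fun i => Real.exp (hA'.eigenvalues i))
      (fun i _ => (Real.exp_pos _).le) (Finset.mem_univ i))

omit [DecidableEq m] in
theorem dotProduct_self_nonneg_real (f : m → ℝ) : 0 ≤ f ⬝ᵥ f :=
  Finset.sum_nonneg fun i _ => mul_self_nonneg (f i)

theorem dotProduct_exp_mulVec_nonneg {A : Matrix m m ℝ} (hA : A.IsSymm) (f : m → ℝ) :
    0 ≤ f ⬝ᵥ NormedSpace.exp A *ᵥ f := by
  have h : NormedSpace.exp A
      = NormedSpace.exp ((2 : ℝ)⁻¹ • A) * NormedSpace.exp ((2 : ℝ)⁻¹ • A) := by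
    rw [← exp_add_of_commute _ _ (Commute.refl _), ← two_smul ℝ, smul_smul]
    simp
  rw [h, ← mulVec_mulVec, dotProduct_mulVec, ← mulVec_transpose, (hA.smul _).exp.eq]
  exact dotProduct_self_nonneg_real _

omit [DecidableEq m] in
theorem trace_mul_vecMulVec_self (H : Matrix m m ℝ) (f : m → ℝ) :
    (H * vecMulVec f f).trace = f ⬝ᵥ H *ᵥ f := by
  rw [mul_vecMulVec, trace_vecMulVec, dotProduct_comm]

theorem trace_mul_exp_vecMulVec_le {H : Matrix m m ℝ} {f : m → ℝ} (hH : 0 ≤ f ⬝ᵥ H *ᵥ f) {L : ℝ}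
    (hL : 0 < L) (hf : f ⬝ᵥ f ≤ L) :
    (H * NormedSpace.exp (-(Real.log 2 / L) • vecMulVec f f)).trace
      ≤ H.trace - 1 / (2 * L) * (f ⬝ᵥ H *ᵥ f) := by
  rcases eq_or_ne (f ⬝ᵥ f) 0 with h0 | h0
  · have : f = 0 := by simpa using h0
    subst this
    simp
  have hb : 0 < f ⬝ᵥ f := lt_of_le_of_ne (dotProduct_self_nonneg_real f) h0.symm
  set b := f ⬝ᵥ f
  rw [exp_smul_of_mul_self_eq_smul h0 (by
    rw [vecMulVec_mul_vecMulVec, vecMulVec_smul]), mul_add, mul_one, trace_add,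
    mul_smul_comm, trace_smul, trace_mul_vecMulVec_self, smul_eq_mul]
  have hu : b / L ≤ 1 := (div_le_one hL).2 hf
  -- The exponential lies below its chord over `0 ≤ b ≤ L`; the rate `log 2 / L` makes the right
  -- endpoint equal to `1/2`.
  have key : Real.exp (-(Real.log 2 / L) * b) ≤ 1 - b / L / 2 := by
    have := convexOn_exp.2 (Set.mem_univ (0 : ℝ)) (Set.mem_univ (-Real.log 2))
      (sub_nonneg.2 hu) (by positivity : 0 ≤ b / L) (by ring)
    simp only [smul_eq_mul, mul_zero, zero_add, Real.exp_zero, Real.exp_neg,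
      Real.exp_log two_pos] at this
    calc Real.exp (-(Real.log 2 / L) * b) = Real.exp (b / L * -Real.log 2) := by
          congr 1; field_simp
      _ ≤ _ := this
      _ = _ := by ring
  have h1 : (Real.exp (-(Real.log 2 / L) * b) - 1) / b ≤ -(1 / (2 * L)) := by
    rw [div_le_iff₀ hb]
    calc _ ≤ - (b / L / 2) := by linarith
      _ = _ := by field_simp
  nlinarith [mul_le_mul_of_nonneg_right h1 hH]

/-- The trace exponential moment bound behind the matrix Chernoff inequality. -/
theorem sum_pi_prod_mul_trace_exp_le {ι : Type*} [Fintype ι] (w : ι → ℝ) (hw : ∀ x, 0 ≤ w x)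
    (hw1 : ∑ x, w x = 1) (f : ι → m → ℝ) (hf1 : ∑ x, w x • vecMulVec (f x) (f x) = 1) {L : ℝ}
    (hL : 1 ≤ L) (hf : ∀ x, f x ⬝ᵥ f x ≤ L) (n : ℕ) :
    ∑ x : Fin n → ι, (∏ i, w (x i)) * (NormedSpace.exp
        (∑ i, -(Real.log 2 / L) • vecMulVec (f (x i)) (f (x i)))).trace
      ≤ (1 - 1 / (2 * L)) ^ n * Fintype.card m := by
  have hL0 : 0 < L := by linarith
  have hq : 0 ≤ 1 - 1 / (2 * L) := by
    rw [sub_nonneg, div_le_one (by positivity)]; linarith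
  have hsymm (x : ι) : (-(Real.log 2 / L) • vecMulVec (f x) (f x)).IsSymm := by
    refine IsSymm.smul ?_ _
    rw [IsSymm, transpose_vecMulVec]
  -- The invariant is symmetry of the partial sum, which Golden–Thompson requires at each step.
  have := sum_pi_prod_mul_le_pow_mul w hw (fun x => -(Real.log 2 / L) • vecMulVec (f x) (f x))
    (fun A : Matrix m m ℝ => A.IsSymm) (fun A x hA => hA.add (hsymm x))
    (fun A => (NormedSpace.exp A).trace) hq (fun A hA => ?_) n 0 (by simp)
  · simpa [NormedSpace.exp_zero] using this
  · calc ∑ x, w x * (NormedSpace.exp (A + -(Real.log 2 / L) • vecMulVec (f x) (f x))).trace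
        ≤ ∑ x, w x * ((NormedSpace.exp A).trace
            - 1 / (2 * L) * (f x ⬝ᵥ NormedSpace.exp A *ᵥ f x)) := by
          refine Finset.sum_le_sum fun x _ => mul_le_mul_of_nonneg_left ?_ (hw x)
          exact (trace_exp_add_le hA (hsymm x)).trans
            (trace_mul_exp_vecMulVec_le (dotProduct_exp_mulVec_nonneg hA _) hL0 (hf x))
      _ = (NormedSpace.exp A).trace - 1 / (2 * L) *
            (NormedSpace.exp A * ∑ x, w x • vecMulVec (f x) (f x)).trace := by
          simp only [mul_sub, Finset.sum_sub_distrib, ← Finset.sum_mul, hw1, one_mul,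
            Finset.mul_sum, trace_sum, mul_smul_comm, trace_smul, trace_mul_vecMulVec_self,
            smul_eq_mul]
          congr 1
          exact Finset.sum_congr rfl fun x _ => by ring
      _ = _ := by rw [hf1, mul_one]; ring

open Classical in
/-- A matrix Chernoff bound for the smallest eigenvalue of a sum of independent rank one
matrices. -/
theorem sum_pi_prod_le_of_small_eigenvalue {ι : Type*} [Fintype ι] (w : ι → ℝ)
    (hw : ∀ x, 0 ≤ w x) (hw1 : ∑ x, w x = 1) (f : ι → m → ℝ)
    (hf1 : ∑ x, w x • vecMulVec (f x) (f x) = 1) {L : ℝ} (hL : 1 ≤ L)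
    (hf : ∀ x, f x ⬝ᵥ f x ≤ L) (n : ℕ) :
    ∑ x : Fin n → ι with ∃ z, ∑ i, (f (x i) ⬝ᵥ z) ^ 2 < n / 2 * (z ⬝ᵥ z), ∏ i, w (x i)
      ≤ Fintype.card m * Real.exp (-(n / (8 * L))) := by
  have hL0 : 0 < L := by linarith
  have hq : 0 ≤ 1 - 1 / (2 * L) := by
    rw [sub_nonneg, div_le_one (by positivity)]; linarith
  set θ := Real.log 2 / L with hθ
  have hθ0 : 0 < θ := div_pos (Real.log_pos one_lt_two) hL0
  have hP (x : Fin n → ι) : 0 ≤ ∏ i, w (x i) := Finset.prod_nonneg fun i _ => hw _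
  have hsymm (x : Fin n → ι) : (∑ i, -θ • vecMulVec (f (x i)) (f (x i))).IsSymm := by
    rw [IsSymm, transpose_sum]
    simp [transpose_vecMulVec]
  have hT (x : Fin n → ι) : 0 ≤ (NormedSpace.exp
      (∑ i, -θ • vecMulVec (f (x i)) (f (x i)))).trace := by
    rw [trace_exp_eq_sum (by
      rw [IsHermitian, conjTranspose_eq_transpose_of_trivial]; exact hsymm x)]
    positivity
  calc ∑ x : Fin n → ι with ∃ z, ∑ i, (f (x i) ⬝ᵥ z) ^ 2 < n / 2 * (z ⬝ᵥ z), ∏ i, w (x i)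
      ≤ ∑ x : Fin n → ι with ∃ z, ∑ i, (f (x i) ⬝ᵥ z) ^ 2 < n / 2 * (z ⬝ᵥ z),
        Real.exp (θ * (n / 2)) * ((∏ i, w (x i)) * (NormedSpace.exp
          (∑ i, -θ • vecMulVec (f (x i)) (f (x i)))).trace) := by
        refine Finset.sum_le_sum fun x hx => ?_
        obtain ⟨z, hz⟩ := (Finset.mem_filter.1 hx).2
        have h1 : Real.exp (-(θ * (n / 2))) ≤ (NormedSpace.exp
            (∑ i, -θ • vecMulVec (f (x i)) (f (x i)))).trace := by
          refine exp_le_trace_exp (hsymm x) (z := z) ?_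
          have h2 : z ⬝ᵥ (∑ i, -θ • vecMulVec (f (x i)) (f (x i))) *ᵥ z
              = -θ * ∑ i, (f (x i) ⬝ᵥ z) ^ 2 := by
            simp only [sum_mulVec, dotProduct_sum, smul_mulVec, dotProduct_smul, Finset.mul_sum,
              vecMulVec_mulVec, smul_eq_mul]
            refine Finset.sum_congr rfl fun i _ => ?_
            simp [dotProduct_comm z, sq]
          rw [h2]
          nlinarith
        have h3 : 1 ≤ Real.exp (θ * (n / 2)) * (NormedSpace.exp
            (∑ i, -θ • vecMulVec (f (x i)) (f (x i)))).trace := by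
          refine le_trans (le_of_eq ?_) (mul_le_mul_of_nonneg_left h1 (Real.exp_nonneg _))
          rw [← Real.exp_add]; simp
        nlinarith [mul_le_mul_of_nonneg_left h3 (hP x)]
    _ ≤ ∑ x : Fin n → ι, Real.exp (θ * (n / 2)) * ((∏ i, w (x i)) * (NormedSpace.exp
          (∑ i, -θ • vecMulVec (f (x i)) (f (x i)))).trace) := by
        refine Finset.sum_le_univ_sum_of_nonneg fun x => ?_
        exact mul_nonneg (Real.exp_nonneg _) (mul_nonneg (hP x) (hT x))
    _ ≤ Real.exp (θ * (n / 2)) * ((1 - 1 / (2 * L)) ^ n * Fintype.card m) := by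
        rw [← Finset.mul_sum]
        exact mul_le_mul_of_nonneg_left (sum_pi_prod_mul_trace_exp_le w hw hw1 f hf1 hL hf n)
          (Real.exp_nonneg _)
    _ ≤ Real.exp (θ * (n / 2)) * (Real.exp (-(1 / (2 * L))) ^ n * Fintype.card m) := by
        gcongr
        exact Real.one_sub_le_exp_neg _
    _ = Fintype.card m * Real.exp (n / L * ((Real.log 2 - 1) / 2)) := by
        rw [← Real.exp_nat_mul, mul_comm _ (Fintype.card m : ℝ), ← mul_assoc,
          mul_comm (Real.exp _) (Fintype.card m : ℝ), mul_assoc, ← Real.exp_add, hθ]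
        congr 2
        field_simp
        ring
    _ ≤ _ := by
        gcongr
        have h1 : (0 : ℝ) ≤ n / L := by positivity
        -- The exponent obtained is `-(1 - log 2) / 2 * (n / L)`, and `(1 - log 2) / 2` exceeds
        -- `1/8`.
        have h2 := Real.log_two_lt_d9
        have h3 : (n : ℝ) / (8 * L) = n / L * (1 / 8) := by field_simp
        rw [h3]
        nlinarith

end Matrix

/-! ### Bernstein's inequality in a Hilbert space. -/

/-- The power series in `z` has nonnegative coefficients. -/
theorem convexOn_cosh_sqrt : ConvexOn ℝ (Set.Ici 0) fun z : ℝ => Real.cosh √z := by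
  have hs {z : ℝ} (hz : 0 ≤ z) : HasSum (fun n : ℕ => z ^ n / (2 * n).factorial)
      (Real.cosh √z) := by
    simpa only [pow_mul, Real.sq_sqrt hz] using Real.hasSum_cosh √z
  refine ⟨convex_Ici 0, fun p hp q hq a b ha hb hab => ?_⟩
  have hpq : 0 ≤ a • p + b • q := (convex_Ici (0 : ℝ)) hp hq ha hb hab
  refine hasSum_le (fun n => ?_) (hs hpq) (((hs hp).mul_left a).add ((hs hq).mul_left b))
  have := (convexOn_pow n).2 hp hq ha hb hab
  calc (a • p + b • q) ^ n / ((2 * n).factorial : ℝ)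
      ≤ (a • p ^ n + b • q ^ n) / ((2 * n).factorial : ℝ) := by gcongr
    _ = _ := by simp only [smul_eq_mul]; ring

section HilbertBernstein

variable {E : Type*} [NormedAddCommGroup E] [InnerProductSpace ℝ E]

/-- The right side is affine in `⟪y, h⟫`, so the first-order term disappears on averaging over a
centred `h`. This makes `cosh ‖·‖` a substitute for the exponential, with no dependence on
dimension. -/
theorem cosh_norm_add_le (y h : E) :
    Real.cosh ‖y + h‖ ≤ Real.cosh ‖y‖ * Real.cosh ‖h‖
      + Real.sinh ‖y‖ / ‖y‖ * inner ℝ y h + Real.sinh ‖y‖ * (Real.sinh ‖h‖ - ‖h‖) := by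
  rcases eq_or_ne y 0 with rfl | hy
  · simp
  rcases eq_or_ne h 0 with rfl | hh
  · simp
  have ha : 0 < ‖y‖ := norm_pos_iff.2 hy
  have hb : 0 < ‖h‖ := norm_pos_iff.2 hh
  set a := ‖y‖ with haa
  set b := ‖h‖ with hbb
  have hi := abs_le.1 (abs_real_inner_le_norm y h)
  set s : ℝ := inner ℝ y h with hs
  have hab : 0 < a * b := mul_pos ha hb
  have hc1 : -1 ≤ s / (a * b) := by rw [le_div_iff₀ hab]; linarith [hi.1]
  have hc2 : s / (a * b) ≤ 1 := by rw [div_le_one hab]; exact hi.2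
  set c := s / (a * b) with hcc
  have hsc : s = c * (a * b) := by rw [hcc]; field_simp
  -- With `c` the cosine of the angle, `‖y + h‖²` is the mixture of `(a + b)²` and `(a - b)²` with
  -- weights `(1 ± c) / 2`.
  have key := convexOn_cosh_sqrt.2 (Set.mem_Ici.2 (sq_nonneg (a + b)))
    (Set.mem_Ici.2 (sq_nonneg (a - b))) (by linarith : 0 ≤ (1 + c) / 2)
    (by linarith : 0 ≤ (1 - c) / 2) (by ring)
  have hz : (1 + c) / 2 * (a + b) ^ 2 + (1 - c) / 2 * (a - b) ^ 2 = ‖y + h‖ ^ 2 := by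
    rw [norm_add_sq_real, ← hs, ← haa, ← hbb, hsc]
    ring
  simp only [smul_eq_mul, hz, Real.sqrt_sq_eq_abs, Real.cosh_abs, abs_norm] at key
  rw [Real.cosh_add, Real.cosh_sub] at key
  have h1 : b ≤ Real.sinh b := Real.self_le_sinh_iff.2 hb.le
  have h2 : 0 < Real.sinh a := Real.sinh_pos_iff.2 ha
  have h3 : Real.sinh a / a * s = Real.sinh a * (c * b) := by rw [hsc]; field_simp
  rw [h3]
  nlinarith [mul_nonneg h2.le (mul_nonneg (sub_nonneg.2 hc2) (sub_nonneg.2 h1))]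

variable {ι : Type*} [Fintype ι] (w : ι → ℝ) (hw : ∀ x, 0 ≤ w x) (hw1 : ∑ x, w x = 1)
  (Z : ι → E) (hZ : ∑ x, w x • Z x = 0)

include hw hw1 hZ in
theorem sum_pi_prod_mul_cosh_norm_le {l M v : ℝ} (hl : 0 ≤ l) (hM : ∀ x, ‖Z x‖ ≤ M)
    (hlM : l * M ≤ 1) (hv : ∑ x, w x * ‖Z x‖ ^ 2 ≤ v) (n : ℕ) :
    ∑ x : Fin n → ι, (∏ i, w (x i)) * Real.cosh (l * ‖∑ i, Z (x i)‖) ≤ (1 + l ^ 2 * v) ^ n := by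
  have hv0 : 0 ≤ v := le_trans (Finset.sum_nonneg fun x _ => by have := hw x; positivity) hv
  have := sum_pi_prod_mul_le_pow_mul w hw (fun x => l • Z x) (fun _ => True)
    (fun _ _ _ => trivial) (fun y => Real.cosh ‖y‖) (q := 1 + l ^ 2 * v) (by positivity)
    (fun y _ => ?_) n 0 trivial
  · simpa only [zero_add, ← Finset.smul_sum, norm_smul, Real.norm_of_nonneg hl, norm_zero,
      Real.cosh_zero, mul_one] using this
  · have hn (x : ι) : ‖l • Z x‖ = l * ‖Z x‖ := by rw [norm_smul, Real.norm_of_nonneg hl]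
    have hstep (x : ι) : Real.cosh ‖y + l • Z x‖ ≤ Real.cosh ‖y‖ * (1 + l ^ 2 * ‖Z x‖ ^ 2)
        + Real.sinh ‖y‖ / ‖y‖ * (l * inner ℝ y (Z x)) := by
      have h1 := cosh_norm_add_le y (l • Z x)
      rw [hn, inner_smul_right] at h1
      set b := l * ‖Z x‖ with hb
      have hb0 : 0 ≤ b := by positivity
      have hb1 : b ≤ 1 := (mul_le_mul_of_nonneg_left (hM x) hl).trans hlM
      have h2 : Real.sinh ‖y‖ ≤ Real.cosh ‖y‖ := (Real.sinh_lt_cosh _).le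
      have h3 : b ≤ Real.sinh b := Real.self_le_sinh_iff.2 hb0
      -- Once `sinh ‖y‖` is replaced by `cosh ‖y‖`, the factor is `cosh b + sinh b - b = exp b - b`,
      -- at most `1 + b²` for `b ≤ 1`.
      have h4 := (abs_le.1 (Real.abs_exp_sub_one_sub_id_le (x := b) (by rwa [abs_of_nonneg hb0]))).2
      have h5 := Real.cosh_add_sinh b
      have h6 := Real.cosh_pos ‖y‖
      have h7 : l ^ 2 * ‖Z x‖ ^ 2 = b ^ 2 := by rw [hb]; ring
      rw [h7]
      nlinarith [mul_le_mul_of_nonneg_right h2 (sub_nonneg.2 h3)]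
    calc ∑ x, w x * Real.cosh ‖y + l • Z x‖
        ≤ ∑ x, w x * (Real.cosh ‖y‖ * (1 + l ^ 2 * ‖Z x‖ ^ 2)
          + Real.sinh ‖y‖ / ‖y‖ * (l * inner ℝ y (Z x))) :=
          Finset.sum_le_sum fun x _ => mul_le_mul_of_nonneg_left (hstep x) (hw x)
      _ = Real.cosh ‖y‖ * (∑ x, w x + l ^ 2 * ∑ x, w x * ‖Z x‖ ^ 2)
          + Real.sinh ‖y‖ / ‖y‖ * l * inner ℝ y (∑ x, w x • Z x) := by
          simp only [inner_sum, inner_smul_right, Finset.mul_sum, ← Finset.sum_add_distrib]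
          exact Finset.sum_congr rfl fun x _ => by ring
      _ ≤ (1 + l ^ 2 * v) * Real.cosh ‖y‖ := by
          rw [hw1, hZ, inner_zero_right, mul_zero, add_zero, mul_comm]
          gcongr

open Classical in
include hw hw1 hZ in
theorem sum_pi_prod_le_of_lt_norm_sum {l M v R : ℝ} (hl : 0 ≤ l) (hM : ∀ x, ‖Z x‖ ≤ M)
    (hlM : l * M ≤ 1) (hv : ∑ x, w x * ‖Z x‖ ^ 2 ≤ v) (n : ℕ) :
    ∑ x : Fin n → ι with R < ‖∑ i, Z (x i)‖, ∏ i, w (x i)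
      ≤ 2 * Real.exp (n * l ^ 2 * v - l * R) := by
  have hv0 : 0 ≤ v := le_trans (Finset.sum_nonneg fun x _ => by have := hw x; positivity) hv
  have hP (x : Fin n → ι) : 0 ≤ ∏ i, w (x i) := Finset.prod_nonneg fun i _ => hw _
  calc ∑ x : Fin n → ι with R < ‖∑ i, Z (x i)‖, ∏ i, w (x i)
      ≤ ∑ x : Fin n → ι with R < ‖∑ i, Z (x i)‖,
          2 * Real.exp (-(l * R)) * ((∏ i, w (x i)) * Real.cosh (l * ‖∑ i, Z (x i)‖)) := by
        refine Finset.sum_le_sum fun x hx => ?_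
        have hx' : R < ‖∑ i, Z (x i)‖ := (Finset.mem_filter.1 hx).2
        have h1 : Real.exp (l * R) ≤ 2 * Real.cosh (l * ‖∑ i, Z (x i)‖) := by
          rw [Real.cosh_eq]
          have : Real.exp (l * R) ≤ Real.exp (l * ‖∑ i, Z (x i)‖) :=
            Real.exp_le_exp.2 (mul_le_mul_of_nonneg_left hx'.le hl)
          linarith [Real.exp_pos (-(l * ‖∑ i, Z (x i)‖))]
        have h2 := mul_le_mul_of_nonneg_left h1 (Real.exp_nonneg (-(l * R)))
        rw [← Real.exp_add, neg_add_cancel, Real.exp_zero] at h2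
        nlinarith [mul_le_mul_of_nonneg_left h2 (hP x)]
    _ ≤ ∑ x : Fin n → ι,
          2 * Real.exp (-(l * R)) * ((∏ i, w (x i)) * Real.cosh (l * ‖∑ i, Z (x i)‖)) := by
        refine Finset.sum_le_univ_sum_of_nonneg fun x => ?_
        have := hP x
        have := Real.cosh_pos (l * ‖∑ i, Z (x i)‖)
        positivity
    _ ≤ 2 * Real.exp (-(l * R)) * (1 + l ^ 2 * v) ^ n := by
        rw [← Finset.mul_sum]
        exact mul_le_mul_of_nonneg_left
          (sum_pi_prod_mul_cosh_norm_le w hw hw1 Z hZ hl hM hlM hv n) (by positivity)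
    _ ≤ 2 * Real.exp (-(l * R)) * Real.exp (l ^ 2 * v) ^ n := by
        gcongr
        linarith [Real.add_one_le_exp (l ^ 2 * v)]
    _ = _ := by
        rw [← Real.exp_nat_mul, mul_assoc, ← Real.exp_add]
        congr 2
        ring

open Classical in
include hw hw1 hZ in
/-- A dimension-free Bernstein inequality for independent bounded vectors in a Hilbert space. -/
theorem sum_pi_prod_le_of_lt_norm_sum_sq {M v t : ℝ} (hM : ∀ x, ‖Z x‖ ≤ M) (hM0 : 0 ≤ M)
    (hv : ∑ x, w x * ‖Z x‖ ^ 2 ≤ v) (ht : 0 < t) (n : ℕ) :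
    ∑ x : Fin n → ι with 5 / 4 * t ^ 2 * M ^ 2 + 20 * n * v * t < ‖∑ i, Z (x i)‖ ^ 2,
      ∏ i, w (x i) ≤ 2 * Real.exp (-t) := by
  have hv0 : 0 ≤ v := le_trans (Finset.sum_nonneg fun x _ => by have := hw x; positivity) hv
  have hP (x : Fin n → ι) : 0 ≤ ∏ i, w (x i) := Finset.prod_nonneg fun i _ => hw _
  rcases hM0.eq_or_lt with hM1 | hM1
  · have hZ0 (x : ι) : Z x = 0 := norm_le_zero_iff.1 ((hM x).trans hM1.symm.le)
    rw [Finset.sum_eq_zero]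
    · positivity
    · intro x hx
      have := (Finset.mem_filter.1 hx).2
      simp only [hZ0, Finset.sum_const_zero, norm_zero] at this
      have h2 : 0 ≤ 5 / 4 * t ^ 2 * M ^ 2 + 20 * n * v * t := by positivity
      norm_num at this
      linarith
  set r := √(n * v / t) with hr
  have hr0 : 0 ≤ r := Real.sqrt_nonneg _
  have hr2 : n * v = r ^ 2 * t := by
    rw [hr, Real.sq_sqrt (by positivity)]; field_simp
  have hMr : 0 < M + r := by linarith
  have hlM : (M + r)⁻¹ * M ≤ 1 := by
    rw [inv_mul_le_iff₀ hMr]; linarith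
  -- Take `l = 1 / (M + r)` and radius `t (M + 2r)`. With `q = r / (M + r) ≤ 1` the exponent is `t
  -- (q² - 1 - q) ≤ -t`. The squared radius is within the threshold because `(M - 8r)² ≥ 0`.
  refine le_trans ?_ ((sum_pi_prod_le_of_lt_norm_sum w hw hw1 Z hZ (inv_nonneg.2 hMr.le) hM hlM hv
    n (R := t * (M + 2 * r))).trans ?_)
  · refine Finset.sum_le_sum_of_subset_of_nonneg (fun x hx => ?_) fun x _ _ => hP x
    simp only [Finset.mem_filter, Finset.mem_univ, true_and] at hx ⊢
    refine lt_of_pow_lt_pow_left₀ 2 (norm_nonneg _) (lt_of_le_of_lt ?_ hx)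
    have h1 : 20 * n * v * t = 20 * (r ^ 2 * t) * t := by rw [← hr2]; ring
    rw [h1]
    nlinarith [sq_nonneg (t * (M - 8 * r))]
  · gcongr
    have h1 : (n : ℝ) * (M + r)⁻¹ ^ 2 * v - (M + r)⁻¹ * (t * (M + 2 * r))
        = t * ((r / (M + r)) ^ 2 - (M + 2 * r) / (M + r)) := by
      rw [show (n : ℝ) * (M + r)⁻¹ ^ 2 * v = n * v * (M + r)⁻¹ ^ 2 by ring, hr2]
      field_simp
    have h2 : (r / (M + r)) ^ 2 ≤ r / (M + r) := by
      have h3 : r / (M + r) ≤ 1 := (div_le_one hMr).2 (by linarith)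
      have h4 : 0 ≤ r / (M + r) := by positivity
      nlinarith
    have h5 : (M + 2 * r) / (M + r) = 1 + r / (M + r) := by field_simp; ring
    rw [h1, h5]
    nlinarith

end HilbertBernstein

/-! ### Squared norms of sub-Gaussian vectors. -/

theorem lintegral_pi_prod_eq_prod_lintegral {ι : Type*} [Fintype ι] {X : ι → Type*}
    [∀ i, MeasurableSpace (X i)] (ρ : ∀ i, Measure (X i)) [∀ i, IsProbabilityMeasure (ρ i)]
    {f : ∀ i, X i → ℝ≥0∞} (hf : ∀ i, Measurable (f i)) :
    ∫⁻ y, ∏ i, f i (y i) ∂(Measure.pi ρ) = ∏ i, ∫⁻ x, f i x ∂(ρ i) := by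
  refine (lintegral_prod_eq_prod_lintegral_of_indepFun Finset.univ
    (fun i (y : ∀ i, X i) => f i (y i)) (iIndepFun_pi fun i => (hf i).aemeasurable)
    fun i => (hf i).comp (measurable_pi_apply i)).trans ?_
  refine Finset.prod_congr rfl fun i _ => ?_
  rw [← (measurePreserving_eval ρ i).lintegral_comp (hf i)]

theorem lintegral_exp_sq_div_four_gaussianReal :
    ∫⁻ x, ENNReal.ofReal (Real.exp (x ^ 2 / 4)) ∂(gaussianReal 0 1) = ENNReal.ofReal √2 := by
  rw [gaussianReal_of_var_ne_zero _ one_ne_zero, lintegral_withDensity_eq_lintegral_mul _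
    (measurable_gaussianPDF 0 1) (by fun_prop)]
  have h (x : ℝ) : (gaussianPDF 0 1 * fun x => ENNReal.ofReal (Real.exp (x ^ 2 / 4))) x
      = ENNReal.ofReal √2 * gaussianPDF 0 2 x := by
    simp only [Pi.mul_apply, gaussianPDF_def]
    rw [← ENNReal.ofReal_mul (gaussianPDFReal_nonneg _ _ _), ← ENNReal.ofReal_mul (by positivity)]
    congr 1
    simp only [gaussianPDFReal, sub_zero, NNReal.coe_one, mul_one, NNReal.coe_ofNat]
    rw [mul_assoc, ← Real.exp_add, Real.sqrt_mul (by positivity) 2, mul_inv,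
      show -x ^ 2 / 2 + x ^ 2 / 4 = -x ^ 2 / (2 * 2) by ring]
    field_simp
  simp_rw [h]
  rw [lintegral_const_mul _ (measurable_gaussianPDF 0 2), lintegral_gaussianPDF_eq_one 0 two_ne_zero,
    mul_one]

theorem lintegral_exp_mul_gaussianReal (t : ℝ) :
    ∫⁻ x, ENNReal.ofReal (Real.exp (t * x)) ∂(gaussianReal 0 1)
      = ENNReal.ofReal (Real.exp (t ^ 2 / 2)) := by
  rw [← ofReal_integral_eq_lintegral_ofReal (integrable_exp_mul_gaussianReal t)
    (ae_of_all _ fun _ => (Real.exp_pos _).le)]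
  congr 1
  have := mgf_gaussianReal (p := gaussianReal 0 1) (X := id) (μ := 0) (v := 1) (by simp) t
  simpa [mgf] using this

/-- Exponential moments of the squared norm of a linear image of a sub-Gaussian vector, by
Gaussian linearization. -/
theorem lintegral_exp_norm_sq_le {Ω : Type*} [MeasurableSpace Ω] (μ : Measure Ω) [SFinite μ]
    {n k : ℕ} (η : Fin n → Ω → ℝ) (hη : ∀ i, Measurable (η i)) {p : ℝ≥0∞} {σ : ℝ}
    (hsub : ∀ a : Fin n → ℝ, ∫⁻ ω, ENNReal.ofReal (Real.exp (∑ i, a i * η i ω)) ∂μ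
      ≤ p * ENNReal.ofReal (Real.exp (σ ^ 2 * (∑ i, a i ^ 2) / 2)))
    (b : Fin n → EuclideanSpace ℝ (Fin k)) {κ : ℝ}
    (hb : ∀ z, ∑ i, inner ℝ (b i) z ^ 2 ≤ κ * ‖z‖ ^ 2) {τ : ℝ} (hτ : 2 * (τ ^ 2 * σ ^ 2 * κ) ≤ 1) :
    ∫⁻ ω, ENNReal.ofReal (Real.exp (τ ^ 2 * ‖∑ i, η i ω • b i‖ ^ 2 / 2)) ∂μ
      ≤ p * ENNReal.ofReal √2 ^ k := by
  set γ : Measure (Fin k → ℝ) := Measure.pi fun _ => gaussianReal 0 1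
  set W : Ω → EuclideanSpace ℝ (Fin k) := fun ω => ∑ i, η i ω • b i with hW
  have hWj (ω : Ω) (j : Fin k) : W ω j = ∑ i, η i ω * b i j := by simp [hW]
  have hWm (j : Fin k) : Measurable fun ω => W ω j := by
    simp_rw [hWj]
    fun_prop
  -- The quadratic exponential is the Gaussian average of linear ones. After Tonelli the
  -- sub-Gaussian bound applies for fixed `g`, and `hτ` leaves at most `exp (‖g‖² / 4)`, of Gaussian
  -- mean `√2 ^ k`. The factor `p` allows unnormalized `μ`, such as a slice of fixed states.
  have h1 (ω : Ω) : ENNReal.ofReal (Real.exp (τ ^ 2 * ‖W ω‖ ^ 2 / 2))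
      = ∫⁻ g : Fin k → ℝ, ENNReal.ofReal (Real.exp (∑ j, τ * W ω j * g j)) ∂γ := by
    simp_rw [Real.exp_sum, ENNReal.ofReal_prod_of_nonneg fun _ _ => (Real.exp_pos _).le]
    rw [lintegral_pi_prod_eq_prod_lintegral (fun _ : Fin k => gaussianReal 0 1)
      (f := fun j x => ENNReal.ofReal (Real.exp (τ * W ω j * x))) (fun j => by fun_prop)]
    simp_rw [lintegral_exp_mul_gaussianReal]
    rw [← ENNReal.ofReal_prod_of_nonneg fun _ _ => (Real.exp_pos _).le, ← Real.exp_sum,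
      EuclideanSpace.norm_sq_eq, Finset.mul_sum, Finset.sum_div]
    congr 2
    refine Finset.sum_congr rfl fun j _ => ?_
    rw [Real.norm_eq_abs, sq_abs]
    ring
  have hmeas : Measurable fun q : Ω × (Fin k → ℝ) =>
      ENNReal.ofReal (Real.exp (∑ j, τ * W q.1 j * q.2 j)) := by
    have (j : Fin k) : Measurable fun q : Ω × (Fin k → ℝ) => W q.1 j := (hWm j).comp measurable_fst
    fun_prop
  change ∫⁻ ω, ENNReal.ofReal (Real.exp (τ ^ 2 * ‖W ω‖ ^ 2 / 2)) ∂μ ≤ _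
  simp_rw [h1]
  rw [lintegral_lintegral_swap hmeas.aemeasurable]
  calc ∫⁻ g, ∫⁻ ω, ENNReal.ofReal (Real.exp (∑ j, τ * W ω j * g j)) ∂μ ∂γ
      ≤ ∫⁻ g : Fin k → ℝ, p * ∏ j, ENNReal.ofReal (Real.exp (g j ^ 2 / 4)) ∂γ := by
        refine lintegral_mono fun g => ?_
        set z : EuclideanSpace ℝ (Fin k) := WithLp.toLp 2 g with hz
        have h2 (ω : Ω) : ∑ j, τ * W ω j * g j = ∑ i, (τ * inner ℝ (b i) z) * η i ω := by
          simp only [hWj, Finset.mul_sum, Finset.sum_mul, PiLp.inner_apply, hz]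
          rw [Finset.sum_comm]
          refine Finset.sum_congr rfl fun i _ => Finset.sum_congr rfl fun j _ => ?_
          simp
          ring
        simp_rw [h2]
        refine (hsub _).trans ?_
        rw [← ENNReal.ofReal_prod_of_nonneg fun _ _ => (Real.exp_pos _).le, ← Real.exp_sum]
        gcongr
        have h3 : ∑ j, g j ^ 2 / 4 = ‖z‖ ^ 2 / 4 := by
          rw [← Finset.sum_div, EuclideanSpace.norm_sq_eq]
          simp [hz]
        have h4 : ∑ i, (τ * inner ℝ (b i) z) ^ 2 = τ ^ 2 * ∑ i, inner ℝ (b i) z ^ 2 := by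
          rw [Finset.mul_sum]; exact Finset.sum_congr rfl fun i _ => by ring
        rw [h3, h4]
        have h5 := mul_le_mul_of_nonneg_left (hb z) (by positivity : 0 ≤ σ ^ 2 * τ ^ 2)
        have h6 := mul_le_mul_of_nonneg_right hτ (sq_nonneg ‖z‖)
        linarith
    _ = p * ENNReal.ofReal √2 ^ k := by
        rw [lintegral_const_mul _ (by fun_prop), lintegral_pi_prod_eq_prod_lintegral
          (fun _ : Fin k => gaussianReal 0 1)
          (f := fun _ x => ENNReal.ofReal (Real.exp (x ^ 2 / 4))) (fun j => by fun_prop)]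
        simp [lintegral_exp_sq_div_four_gaussianReal]

theorem measure_le_norm_sq_le_of_pos {Ω : Type*} [MeasurableSpace Ω] (μ : Measure Ω) [SFinite μ]
    {n k : ℕ} (η : Fin n → Ω → ℝ) (hη : ∀ i, Measurable (η i)) {p : ℝ≥0∞} {σ : ℝ} (hσ : 0 < σ)
    (hsub : ∀ a : Fin n → ℝ, ∫⁻ ω, ENNReal.ofReal (Real.exp (∑ i, a i * η i ω)) ∂μ
      ≤ p * ENNReal.ofReal (Real.exp (σ ^ 2 * (∑ i, a i ^ 2) / 2)))
    (b : Fin n → EuclideanSpace ℝ (Fin k)) {κ : ℝ} (hκ : 0 < κ)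
    (hb : ∀ z, ∑ i, inner ℝ (b i) z ^ 2 ≤ κ * ‖z‖ ^ 2) (t : ℝ) :
    μ {ω | κ * σ ^ 2 * (2 * k + 4 * t) ≤ ‖∑ i, η i ω • b i‖ ^ 2}
      ≤ p * ENNReal.ofReal (Real.exp (-t)) := by
  set τ := √(1 / (2 * σ ^ 2 * κ)) with hτ
  have hτ2 : τ ^ 2 = 1 / (2 * σ ^ 2 * κ) := Real.sq_sqrt (by positivity)
  have h1 := lintegral_exp_norm_sq_le μ η hη hsub b hb (τ := τ)
    (by rw [hτ2]; apply le_of_eq; field_simp)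
  -- At the threshold the exponent is `(2k + 4t) / 4 = k/2 + t`; the part `k/2` absorbs `√2 ^ k` in
  -- Markov's inequality.
  set ε := ENNReal.ofReal (Real.exp (k / 2 + t)) with hε
  have hε0 : ε ≠ 0 := by simp [hε, Real.exp_pos]
  have hm : Measurable fun ω => ENNReal.ofReal (Real.exp (τ ^ 2 * ‖∑ i, η i ω • b i‖ ^ 2 / 2)) := by
    have : Measurable fun ω => ∑ i, η i ω • b i :=
      Finset.measurable_sum _ fun i _ => (hη i).smul_const _
    fun_prop
  calc μ {ω | κ * σ ^ 2 * (2 * k + 4 * t) ≤ ‖∑ i, η i ω • b i‖ ^ 2}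
      ≤ μ {ω | ε ≤ ENNReal.ofReal (Real.exp (τ ^ 2 * ‖∑ i, η i ω • b i‖ ^ 2 / 2))} := by
        refine measure_mono fun ω hω => ?_
        refine ENNReal.ofReal_le_ofReal (Real.exp_le_exp.2 ?_)
        rw [hτ2]
        have hω' := mul_le_mul_of_nonneg_left (Set.mem_ofPred_eq ▸ hω)
          (by positivity : 0 ≤ 1 / (2 * σ ^ 2 * κ))
        refine le_trans (le_of_eq ?_) (div_le_div_of_nonneg_right hω' zero_le_two)
        field_simp
        ring
    _ ≤ p * ENNReal.ofReal √2 ^ k / ε :=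
        (meas_ge_le_lintegral_div hm.aemeasurable hε0 ENNReal.ofReal_ne_top).trans (by gcongr)
    _ ≤ p * ENNReal.ofReal (Real.exp (-t)) := by
        rw [mul_div_assoc, ← ENNReal.ofReal_pow (by positivity), hε,
          ← ENNReal.ofReal_div_of_pos (Real.exp_pos _)]
        gcongr
        have h2 : √2 ≤ Real.exp (1 / 2) := by
          rw [Real.sqrt_le_left (Real.exp_pos _).le, ← Real.exp_nat_mul]
          have := Real.add_one_le_exp (1 : ℝ)
          norm_num at this ⊢
          linarith
        rw [div_le_iff₀ (Real.exp_pos _), ← Real.exp_add]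
        calc √2 ^ k ≤ Real.exp (1 / 2) ^ k := by gcongr
          _ = _ := by rw [← Real.exp_nat_mul]; congr 1; ring

/-- A tail bound for the squared norm of a linear image of a sub-Gaussian vector. -/
theorem measure_lt_norm_sq_le {Ω : Type*} [MeasurableSpace Ω] (μ : Measure Ω) [SFinite μ]
    {n k : ℕ} (η : Fin n → Ω → ℝ) (hη : ∀ i, Measurable (η i)) {p : ℝ≥0∞} {σ : ℝ} (hσ : 0 ≤ σ)
    (hsub : ∀ a : Fin n → ℝ, ∫⁻ ω, ENNReal.ofReal (Real.exp (∑ i, a i * η i ω)) ∂μ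
      ≤ p * ENNReal.ofReal (Real.exp (σ ^ 2 * (∑ i, a i ^ 2) / 2)))
    (b : Fin n → EuclideanSpace ℝ (Fin k)) {κ : ℝ} (hκ : 0 < κ)
    (hb : ∀ z, ∑ i, inner ℝ (b i) z ^ 2 ≤ κ * ‖z‖ ^ 2) {t : ℝ} (ht : 0 ≤ t) :
    μ {ω | κ * σ ^ 2 * (2 * k + 4 * t) < ‖∑ i, η i ω • b i‖ ^ 2}
      ≤ p * ENNReal.ofReal (Real.exp (-t)) := by
  -- The case `σ = 0` is reached by letting positive parameters decrease to `σ`; the strict event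
  -- lies in the increasing union of the approximating events.
  set s : ℕ → ℝ := fun j => σ + 1 / ((j : ℝ) + 1) with hs
  have hlim : Filter.Tendsto (fun j => κ * s j ^ 2 * (2 * k + 4 * t)) Filter.atTop
      (nhds (κ * σ ^ 2 * (2 * k + 4 * t))) := by
    have : Filter.Tendsto s Filter.atTop (nhds (σ + 0)) :=
      tendsto_const_nhds.add tendsto_one_div_add_atTop_nhds_zero_nat
    rw [add_zero] at this
    exact ((this.pow 2).const_mul κ).mul_const _
  have hanti : Antitone s := fun i j hij => by
    simp only [hs]
    gcongr
  have hs0 (j : ℕ) : 0 < s j := by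
    have : 0 < 1 / ((j : ℝ) + 1) := by positivity
    simp only [hs]; linarith
  have hsσ (j : ℕ) : σ ≤ s j := by
    have : 0 < 1 / ((j : ℝ) + 1) := by positivity
    simp only [hs]; linarith
  have hmono : Monotone fun j => {ω | κ * s j ^ 2 * (2 * k + 4 * t) ≤ ‖∑ i, η i ω • b i‖ ^ 2} := by
    intro i j hij ω hω
    rw [Set.mem_ofPred_eq] at hω ⊢
    refine le_trans ?_ hω
    have := hanti hij
    have := hs0 j
    gcongr
  calc μ {ω | κ * σ ^ 2 * (2 * k + 4 * t) < ‖∑ i, η i ω • b i‖ ^ 2}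
      ≤ μ (⋃ j, {ω | κ * s j ^ 2 * (2 * k + 4 * t) ≤ ‖∑ i, η i ω • b i‖ ^ 2}) := by
        refine measure_mono fun ω hω => ?_
        obtain ⟨j, hj⟩ := (hlim.eventually_lt_const hω).exists
        exact Set.mem_iUnion.2 ⟨j, hj.le⟩
    _ ≤ p * ENNReal.ofReal (Real.exp (-t)) := by
        rw [hmono.measure_iUnion]
        refine iSup_le fun j => measure_le_norm_sq_le_of_pos μ η hη (hs0 j) (fun a => ?_) b hκ hb t
        refine (hsub a).trans ?_
        have := hsσ j
        gcongr

/-! ### Conditioning on the states. -/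

/-- Conditionally on the states, the noise vector is sub-Gaussian. -/
theorem setLIntegral_exp_sum_le {S n : ℕ} (ν : Measure (Fin S)) [IsProbabilityMeasure ν] (σ : ℝ≥0)
    (ξ : Kernel (Fin S) ℝ) [IsMarkovKernel ξ] (hξ : ∀ x, HasSubgaussianMGF id (σ ^ 2) (ξ x))
    (x : Fin n → Fin S) (a : Fin n → ℝ) :
    ∫⁻ y in {y | ∀ i, (y i).1 = x i}, ENNReal.ofReal (Real.exp (∑ i, a i * (y i).2))
        ∂(Measure.pi fun _ : Fin n => ν ⊗ₘ ξ)
      ≤ (∏ i, ν {x i}) * ENNReal.ofReal (Real.exp ((σ : ℝ) ^ 2 * (∑ i, a i ^ 2) / 2)) := by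
  have hms : MeasurableSet {y : Fin n → Fin S × ℝ | ∀ i, (y i).1 = x i} := by
    rw [Set.ofPred_forall]
    exact MeasurableSet.iInter fun i =>
      (measurable_fst.comp (measurable_pi_apply i)) (measurableSet_singleton (x i))
  have hm (i : Fin n) : Measurable fun q : Fin S × ℝ =>
      ({x i} ×ˢ Set.univ : Set (Fin S × ℝ)).indicator
        (fun q => ENNReal.ofReal (Real.exp (a i * q.2))) q :=
    Measurable.indicator (by fun_prop) ((measurableSet_singleton _).prod .univ)
  rw [← lintegral_indicator hms]
  have h1 (y : Fin n → Fin S × ℝ) : {y : Fin n → Fin S × ℝ | ∀ i, (y i).1 = x i}.indicator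
      (fun y => ENNReal.ofReal (Real.exp (∑ i, a i * (y i).2))) y
      = ∏ i, ({x i} ×ˢ Set.univ : Set (Fin S × ℝ)).indicator
        (fun q => ENNReal.ofReal (Real.exp (a i * q.2))) (y i) := by
    by_cases h : ∀ i, (y i).1 = x i
    · rw [Set.indicator_of_mem (by rwa [Set.mem_ofPred_eq]), Real.exp_sum,
        ENNReal.ofReal_prod_of_nonneg fun _ _ => (Real.exp_pos _).le]
      refine Finset.prod_congr rfl fun i _ => ?_
      rw [Set.indicator_of_mem (Set.mem_prod.2 ⟨Set.mem_singleton_iff.2 (h i), Set.mem_univ _⟩)]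
    · rw [Set.indicator_of_notMem (by rwa [Set.mem_ofPred_eq])]
      push Not at h
      obtain ⟨i, hi⟩ := h
      exact (Finset.prod_eq_zero (Finset.mem_univ i)
        (Set.indicator_of_notMem
          (fun hc => hi (Set.mem_singleton_iff.1 (Set.mem_prod.1 hc).1)) _)).symm
  simp_rw [h1]
  rw [lintegral_pi_prod_eq_prod_lintegral (fun _ : Fin n => ν ⊗ₘ ξ) hm, Finset.mul_sum,
    Finset.sum_div, Real.exp_sum, ENNReal.ofReal_prod_of_nonneg fun _ _ => (Real.exp_pos _).le,
    ← Finset.prod_mul_distrib]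
  refine Finset.prod_le_prod' fun i _ => ?_
  rw [lintegral_indicator ((measurableSet_singleton _).prod .univ),
    Measure.setLIntegral_compProd (by fun_prop) (measurableSet_singleton _) .univ,
    lintegral_singleton, mul_comm, Measure.restrict_univ]
  gcongr
  have h2 := (hξ (x i)).integrable_exp_mul (a i)
  have h3 := (hξ (x i)).mgf_le (a i)
  simp only [id] at h2
  rw [← ofReal_integral_eq_lintegral_ofReal h2 (ae_of_all _ fun _ => (Real.exp_pos _).le)]
  refine ENNReal.ofReal_le_ofReal (le_trans h3 (le_of_eq ?_))
  simp

theorem measure_pi_fst_eq_le {S n : ℕ} (ν : Measure (Fin S)) [IsProbabilityMeasure ν]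
    (ξ : Kernel (Fin S) ℝ) [IsMarkovKernel ξ] {σ : ℝ≥0}
    (hξ : ∀ x, HasSubgaussianMGF id (σ ^ 2) (ξ x)) (x : Fin n → Fin S) :
    (Measure.pi fun _ : Fin n => ν ⊗ₘ ξ) {y | ∀ i, (y i).1 = x i} ≤ ∏ i, ν {x i} := by
  simpa using setLIntegral_exp_sum_le ν σ ξ hξ x 0

/-! ### Estimation error in isotropic coordinates. -/

open Classical in
theorem sum_pi_prod_le_of_small_gram {S k : ℕ} (w : Fin S → ℝ) (hw : ∀ x, 0 ≤ w x)
    (hw1 : ∑ x, w x = 1) (φ : Fin S → EuclideanSpace ℝ (Fin k))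
    (hφ : ∑ x, w x • Matrix.vecMulVec (φ x).ofLp (φ x).ofLp = 1) {L : ℝ} (hL : 1 ≤ L)
    (hφL : ∀ x, ‖φ x‖ ^ 2 ≤ L) (n : ℕ) :
    ∑ x : Fin n → Fin S with ∃ z, ∑ i, inner ℝ (φ (x i)) z ^ 2 < n / 2 * ‖z‖ ^ 2, ∏ i, w (x i)
      ≤ k * Real.exp (-(n / (8 * L))) := by
  have hin (u v : EuclideanSpace ℝ (Fin k)) : inner ℝ u v = u.ofLp ⬝ᵥ v.ofLp := by
    rw [EuclideanSpace.inner_eq_star_dotProduct, star_trivial, dotProduct_comm]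
  have := Matrix.sum_pi_prod_le_of_small_eigenvalue w hw hw1 (fun x => (φ x).ofLp) hφ hL
    (fun x => by rw [← hin, real_inner_self_eq_norm_sq]; exact hφL x) n
  rw [Fintype.card_fin] at this
  refine le_trans (le_of_eq ?_) this
  congr 1
  refine Finset.filter_congr fun x _ => ⟨?_, ?_⟩
  · rintro ⟨z, hz⟩
    refine ⟨z.ofLp, ?_⟩
    simpa only [← hin, real_inner_self_eq_norm_sq] using hz
  · rintro ⟨z, hz⟩
    refine ⟨WithLp.toLp 2 z, ?_⟩
    simpa only [hin, ← real_inner_self_eq_norm_sq] using hz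

/-- Inverting a well-conditioned frame operator. -/
theorem exists_linearMap_leftInverse_frame {ι E : Type*} [Fintype ι] [NormedAddCommGroup E]
    [InnerProductSpace ℝ E] [FiniteDimensional ℝ E] (φ : ι → E) {a : ℝ} (ha : 0 < a)
    (h : ∀ z, a * ‖z‖ ^ 2 ≤ ∑ i, inner ℝ (φ i) z ^ 2) :
    ∃ T : E →ₗ[ℝ] E, (∀ v, ‖T v‖ ≤ a⁻¹ * ‖v‖) ∧
      (∀ z, ∑ i, inner ℝ (T (φ i)) z ^ 2 ≤ a⁻¹ * ‖z‖ ^ 2) ∧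
      ∀ θ, T (∑ i, inner ℝ (φ i) θ • φ i) = θ := by
  let G : E →ₗ[ℝ] E := ∑ i, (innerₗ E (φ i)).smulRight (φ i)
  have hG (z : E) : G z = ∑ i, inner ℝ (φ i) z • φ i := by simp [G]
  have hGi (z u : E) : inner ℝ (G z) u = ∑ i, inner ℝ (φ i) z * inner ℝ (φ i) u := by
    simp [hG, sum_inner, inner_smul_left]
  have hGsymm (z u : E) : inner ℝ (G z) u = inner ℝ z (G u) := by
    rw [real_inner_comm (G u) z, hGi, hGi]
    exact Finset.sum_congr rfl fun i _ => mul_comm _ _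
  have hGq (z : E) : inner ℝ (G z) z = ∑ i, inner ℝ (φ i) z ^ 2 := by
    rw [hGi]; exact Finset.sum_congr rfl fun i _ => (sq _).symm
  have hGn (z : E) : ‖z‖ ≤ a⁻¹ * ‖G z‖ := by
    rcases eq_or_ne z 0 with rfl | hz
    · simp
    have hz' : 0 < ‖z‖ := norm_pos_iff.2 hz
    rw [le_inv_mul_iff₀ ha]
    have h1 := (h z).trans ((hGq z).symm.le.trans (real_inner_le_norm _ _))
    refine le_of_mul_le_mul_right ?_ hz'
    calc a * ‖z‖ * ‖z‖ = a * ‖z‖ ^ 2 := by ring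
      _ ≤ _ := h1
  have hinj : Function.Injective G := by
    rw [← LinearMap.ker_eq_bot, LinearMap.ker_eq_bot']
    intro z hz
    have := hGn z
    rw [hz, norm_zero, mul_zero] at this
    exact norm_le_zero_iff.1 this
  let e := LinearEquiv.ofInjectiveEndo G hinj
  have he (z : E) : G (e.symm z) = z := e.apply_symm_apply z
  have heG (z : E) : e.symm (G z) = z := e.symm_apply_apply z
  refine ⟨e.symm, fun v => ?_, fun z => ?_, fun θ => ?_⟩
  · change ‖e.symm v‖ ≤ _
    simpa only [he] using hGn (e.symm v)
  -- By symmetry of `G` the sum is `⟪z, G⁻¹ z⟫`, which costs one factor `a⁻¹` rather than two; this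
  -- gives the noise term its rate `1/n`.
  · have h1 (i : ι) : inner ℝ (e.symm (φ i)) z = inner ℝ (φ i) (e.symm z) := by
      conv_lhs => rw [← he z]
      rw [← hGsymm, he]
    have hn : ‖e.symm z‖ ≤ a⁻¹ * ‖z‖ := by simpa only [he] using hGn (e.symm z)
    calc ∑ i, inner ℝ (e.symm (φ i)) z ^ 2 = inner ℝ z (e.symm z) := by
          simp_rw [h1]
          rw [← hGq, he]
      _ ≤ ‖z‖ * ‖e.symm z‖ := real_inner_le_norm _ _
      _ ≤ ‖z‖ * (a⁻¹ * ‖z‖) := by gcongr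
      _ = _ := by ring
  · rw [← hG]; exact heG θ

/-- Here `a` is the squared bias part and `b` the squared noise part of `θ`. The constants `384`,
`48` and `64/3` are met with room to spare. -/
theorem le_of_estimation_error_decomposition {n k L B ρ t c σ Θ a b u : ℝ} (hn : 0 < n)
    (hk : 0 ≤ k) (hL : 0 ≤ L) (hρ : 0 ≤ ρ) (ht0 : 0 < t) (htc : t ≤ 4 / 3 * c)
    (hΘ : Θ ≤ 2 * a + 2 * b) (ha : a ≤ 4 / n ^ 2 * u)
    (hu : u ≤ 5 / 4 * t ^ 2 * (L * B ^ 2) + 20 * n * (L * ρ) * t)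
    (hb : b ≤ (n / 2)⁻¹ * σ ^ 2 * (2 * k + 4 * c)) :
    Θ ≤ 384 * (L / n) * ρ * c + 48 * (σ ^ 2 / n) * (2 * k + 3 * c)
      + 64 / 3 * (L / n ^ 2) * B ^ 2 * c ^ 2 := by
  have h4 : 4 / n ^ 2 * u ≤ 5 * t ^ 2 * (L / n ^ 2 * B ^ 2) + 80 * t * (L / n * ρ) := by
    refine (mul_le_mul_of_nonneg_left hu (by positivity)).trans (le_of_eq ?_)
    field_simp
    ring
  have h5 : b ≤ (4 * k + 8 * c) * (σ ^ 2 / n) := by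
    refine hb.trans (le_of_eq ?_)
    field_simp
    ring
  have ht2 : 5 * t ^ 2 ≤ 32 / 3 * c ^ 2 := by
    have := mul_self_le_mul_self ht0.le htc
    nlinarith
  have h6 := mul_le_mul_of_nonneg_right ht2 (by positivity : 0 ≤ L / n ^ 2 * B ^ 2)
  have h7 := mul_le_mul_of_nonneg_right (by linarith : 80 * t ≤ 192 * c)
    (by positivity : 0 ≤ L / n * ρ)
  have h8 := mul_le_mul_of_nonneg_right (by linarith : 4 * k + 8 * c ≤ 24 * (2 * k + 3 * c))
    (by positivity : 0 ≤ σ ^ 2 / n)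
  linarith

/-- The estimation error bound in orthonormalized coordinates, for the product measure. -/
theorem measure_pi_exists_normal_equation_le {S k n : ℕ} (ν : Measure (Fin S))
    [IsProbabilityMeasure ν] (σ : ℝ≥0) (ξ : Kernel (Fin S) ℝ) [IsMarkovKernel ξ]
    (hξ : ∀ x, HasSubgaussianMGF id (σ ^ 2) (ξ x)) {δ : ℝ} (hδ0 : 0 < δ) (hδ1 : δ < 1)
    (φ : Fin S → EuclideanSpace ℝ (Fin k))
    (hφ : ∑ x, ν.real {x} • Matrix.vecMulVec (φ x).ofLp (φ x).ofLp = 1) {L : ℝ} (hL : 1 ≤ L)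
    (hφL : ∀ x, ‖φ x‖ ^ 2 ≤ L) (hk : 0 < k) (hn : 0 < n)
    (hnL : 8 * L * Real.log (6 * k / δ) ≤ n) (g : Fin S → ℝ)
    (hg : ∑ x, ν.real {x} • g x • φ x = 0) {B : ℝ} (hB0 : 0 ≤ B) (hB : ∀ x, |g x| ≤ B) :
    (Measure.pi fun _ : Fin n => ν ⊗ₘ ξ) {y | ∃ θ : EuclideanSpace ℝ (Fin k),
      ∑ i, (inner ℝ (φ (y i).1) θ - g (y i).1 - (y i).2) • φ (y i).1 = 0 ∧
      384 * (L / n) * (∑ x, ν.real {x} * g x ^ 2) * Real.log (3 / δ)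
        + 48 * ((σ : ℝ) ^ 2 / n) * (2 * k + 3 * Real.log (3 / δ))
        + 64 / 3 * (L / (n : ℝ) ^ 2) * B ^ 2 * Real.log (3 / δ) ^ 2 < ‖θ‖ ^ 2}
      ≤ ENNReal.ofReal δ := by
  classical
  set π := Measure.pi fun _ : Fin n => ν ⊗ₘ ξ
  set w : Fin S → ℝ := fun x => ν.real {x} with hwdef
  have hw (x : Fin S) : 0 ≤ w x := measureReal_nonneg
  have hw1 : ∑ x, w x = 1 := by
    simp only [hwdef]
    rw [sum_measureReal_singleton]
    simp
  have hP (x : Fin n → Fin S) : 0 ≤ ∏ i, w (x i) := Finset.prod_nonneg fun i _ => hw _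
  have hnR : (0 : ℝ) < n := by exact_mod_cast hn
  have hkR : (0 : ℝ) < k := by exact_mod_cast hk
  have hL0 : 0 < L := by linarith
  set c := Real.log (3 / δ) with hc
  set t := Real.log (4 / δ) with ht
  have hc1 : 1 ≤ c := by
    rw [hc, Real.le_log_iff_exp_le (by positivity)]
    refine Real.exp_one_lt_three.le.trans ?_
    rw [le_div_iff₀ hδ0]; linarith
  -- Bernstein uses `t = log (4/δ)`, so that `2 exp (-t) = δ/2`. Passing to `c` costs `log (4/3) ≤
  -- 1/3 ≤ c/3`, as `c ≥ 1`.
  have htc : t ≤ 4 / 3 * c := by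
    have h1 : t = Real.log (4 / 3) + c := by
      rw [hc, ht, ← Real.log_mul (by norm_num) (by positivity)]
      congr 1
      ring
    have h2 := Real.log_le_sub_one_of_pos (show (0 : ℝ) < 4 / 3 by norm_num)
    linarith
  have ht0 : 0 < t := Real.log_pos (by rw [lt_div_iff₀ hδ0]; linarith)
  set ρ := ∑ x, w x * g x ^ 2 with hρ
  have hρ0 : 0 ≤ ρ := Finset.sum_nonneg fun x _ => mul_nonneg (hw x) (sq_nonneg _)
  set M := √L * B with hM
  have hM0 : 0 ≤ M := by positivity
  have hM2 : M ^ 2 = L * B ^ 2 := by rw [hM, mul_pow, Real.sq_sqrt hL0.le]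
  have hZM (x : Fin S) : ‖g x • φ x‖ ≤ M := by
    rw [norm_smul, hM, mul_comm]
    gcongr
    · exact Real.le_sqrt_of_sq_le (hφL x)
    · exact hB x
  have hZv : ∑ x, w x * ‖g x • φ x‖ ^ 2 ≤ L * ρ := by
    rw [hρ, Finset.mul_sum]
    refine Finset.sum_le_sum fun x _ => ?_
    rw [norm_smul, mul_pow, Real.norm_eq_abs, sq_abs]
    nlinarith [mul_le_mul_of_nonneg_left (hφL x) (mul_nonneg (hw x) (sq_nonneg (g x)))]
  set bad₁ : (Fin n → Fin S) → Prop := fun x =>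
    ∃ z, ∑ i, inner ℝ (φ (x i)) z ^ 2 < n / 2 * ‖z‖ ^ 2 with hbad₁
  set bad₂ : (Fin n → Fin S) → Prop := fun x =>
    5 / 4 * t ^ 2 * M ^ 2 + 20 * n * (L * ρ) * t < ‖∑ i, g (x i) • φ (x i)‖ ^ 2 with hbad₂
  have hbad₁_le : ∑ x : Fin n → Fin S with bad₁ x, ∏ i, w (x i) ≤ δ / 6 := by
    refine (sum_pi_prod_le_of_small_gram w hw hw1 φ hφ hL hφL n).trans ?_
    have h1 : Real.exp (-(n / (8 * L))) ≤ Real.exp (-Real.log (6 * k / δ)) := by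
      gcongr
      rw [le_div_iff₀ (by positivity)]
      linarith
    rw [Real.exp_neg (Real.log _), Real.exp_log (by positivity)] at h1
    refine (mul_le_mul_of_nonneg_left h1 hkR.le).trans (le_of_eq ?_)
    field_simp
  have hbad₂_le : ∑ x : Fin n → Fin S with bad₂ x, ∏ i, w (x i) ≤ δ / 2 := by
    refine (sum_pi_prod_le_of_lt_norm_sum_sq w hw hw1 (fun x => g x • φ x) hg hZM hM0 hZv ht0
      n).trans (le_of_eq ?_)
    rw [ht, Real.exp_neg, Real.exp_log (by positivity)]
    field_simp
    norm_num
  have hexp : Real.exp (-c) = δ / 3 := by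
    rw [hc, Real.exp_neg, Real.exp_log (by positivity), inv_div]
  set bad : Set (Fin n → Fin S × ℝ) := {y | ∃ θ : EuclideanSpace ℝ (Fin k),
      ∑ i, (inner ℝ (φ (y i).1) θ - g (y i).1 - (y i).2) • φ (y i).1 = 0 ∧
      384 * (L / n) * ρ * c + 48 * ((σ : ℝ) ^ 2 / n) * (2 * k + 3 * c)
        + 64 / 3 * (L / (n : ℝ) ^ 2) * B ^ 2 * c ^ 2 < ‖θ‖ ^ 2} with hbad
  have hprod (x : Fin n → Fin S) : ∏ i, ν {x i} = ENNReal.ofReal (∏ i, w (x i)) := by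
    rw [ENNReal.ofReal_prod_of_nonneg fun _ _ => hw _]
    exact Finset.prod_congr rfl fun i _ => (ofReal_measureReal).symm
  -- A bad state sequence is charged the full mass of its slice; on any other, only the noise can
  -- fail. Summed over `x`, the three terms give `δ/6 + δ/2 + δ/3 = δ`.
  have hslice (x : Fin n → Fin S) : π (bad ∩ {y | ∀ i, (y i).1 = x i}) ≤ ENNReal.ofReal
      ((if bad₁ x then ∏ i, w (x i) else 0) + (if bad₂ x then ∏ i, w (x i) else 0)
        + (∏ i, w (x i)) * Real.exp (-c)) := by
    by_cases hx : bad₁ x ∨ bad₂ x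
    · refine (measure_mono Set.inter_subset_right).trans
        ((measure_pi_fst_eq_le ν ξ hξ x).trans ?_)
      rw [hprod]
      refine ENNReal.ofReal_le_ofReal ?_
      have h1 := mul_nonneg (hP x) (Real.exp_nonneg (-c))
      have h2 := hP x
      rcases hx with hx | hx <;> rw [if_pos hx] <;> split_ifs <;> linarith
    · push Not at hx
      obtain ⟨hx1, hx2⟩ := hx
      rw [if_neg hx1, if_neg hx2, add_zero, zero_add, ENNReal.ofReal_mul (hP x), ← hprod]
      have hframe : ∀ z, (n : ℝ) / 2 * ‖z‖ ^ 2 ≤ ∑ i, inner ℝ (φ (x i)) z ^ 2 := by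
        simpa only [hbad₁, not_exists, not_lt] using hx1
      obtain ⟨T, hT1, hT2, hT3⟩ := exists_linearMap_leftInverse_frame (fun i => φ (x i))
        (by positivity : (0 : ℝ) < n / 2) hframe
      rw [hbad₂, not_lt] at hx2
      refine le_trans ?_ (measure_lt_norm_sq_le (π.restrict {y | ∀ i, (y i).1 = x i})
        (fun i y => (y i).2) (fun i => by fun_prop) σ.2
        (fun a => setLIntegral_exp_sum_le ν σ ξ hξ x a) (fun i => T (φ (x i)))
        (by positivity) hT2 (by linarith : 0 ≤ c))
      refine le_trans (measure_mono ?_) (Measure.le_restrict_apply _ _)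
      rintro y ⟨⟨θ, hθ, hlt⟩, hy⟩
      rw [Set.mem_ofPred_eq] at hy
      refine ⟨?_, hy⟩
      simp only [hy] at hθ
      rw [Set.mem_ofPred_eq]
      by_contra! hnoise
      refine absurd hlt (not_lt.2 ?_)
      have hθ' : θ = T (∑ i, g (x i) • φ (x i)) + ∑ i, (y i).2 • T (φ (x i)) := by
        have h1 : ∑ i, inner ℝ (φ (x i)) θ • φ (x i)
            = ∑ i, g (x i) • φ (x i) + ∑ i, (y i).2 • φ (x i) := by
          rw [← sub_eq_zero, ← hθ]
          simp only [sub_smul, Finset.sum_sub_distrib]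
          abel
        conv_lhs => rw [← hT3 θ]
        rw [h1, map_add, map_sum T (fun i => (y i).2 • φ (x i))]
        simp only [map_smul]
      set u := ∑ i, g (x i) • φ (x i)
      set v := ∑ i, (y i).2 • T (φ (x i))
      have h2 : ‖θ‖ ^ 2 ≤ 2 * ‖T u‖ ^ 2 + 2 * ‖v‖ ^ 2 := by
        rw [hθ']
        nlinarith [norm_add_le (T u) v, norm_nonneg (T u + v), sq_nonneg (‖T u‖ - ‖v‖)]
      have h3 : ‖T u‖ ^ 2 ≤ 4 / (n : ℝ) ^ 2 * ‖u‖ ^ 2 := by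
        calc ‖T u‖ ^ 2 ≤ ((n / 2 : ℝ)⁻¹ * ‖u‖) ^ 2 := by gcongr; exact hT1 u
          _ = _ := by rw [inv_div, mul_pow, div_pow]; norm_num
      exact le_of_estimation_error_decomposition hnR hkR.le hL0.le hρ0 ht0 htc h2 h3
        (hM2 ▸ hx2) hnoise
  calc π bad ≤ π (⋃ x : Fin n → Fin S, bad ∩ {y | ∀ i, (y i).1 = x i}) := by
        refine measure_mono fun y hy => Set.mem_iUnion.2 ⟨fun i => (y i).1, hy, ?_⟩
        rw [Set.mem_ofPred_eq]
        exact fun i => rfl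
    _ ≤ ∑ x : Fin n → Fin S, π (bad ∩ {y | ∀ i, (y i).1 = x i}) := measure_iUnion_fintype_le _ _
    _ ≤ ∑ x : Fin n → Fin S, ENNReal.ofReal
          ((if bad₁ x then ∏ i, w (x i) else 0) + (if bad₂ x then ∏ i, w (x i) else 0)
            + (∏ i, w (x i)) * Real.exp (-c)) := Finset.sum_le_sum fun x _ => hslice x
    _ ≤ ENNReal.ofReal δ := by
        rw [← ENNReal.ofReal_sum_of_nonneg fun x _ => ?_]
        · refine ENNReal.ofReal_le_ofReal ?_
          have hPsum : ∑ x : Fin n → Fin S, ∏ i, w (x i) = 1 := by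
            rw [← Fintype.sum_pow, hw1, one_pow]
          rw [Finset.sum_add_distrib, Finset.sum_add_distrib, ← Finset.sum_filter,
            ← Finset.sum_filter, ← Finset.sum_mul, hPsum, hexp]
          linarith
        · have h1 := mul_nonneg (hP x) (Real.exp_nonneg (-c))
          have h2 := hP x
          split_ifs <;> linarith

/-! ### Normal equations and the weighted column space. -/

theorem isLeastSquares_sum_residual_mul_eq_zero {S k n : ℕ} {Φ : Matrix (Fin S) (Fin k) ℝ}
    {s : Fin n → Fin S} {y : Fin n → ℝ} {w : Fin k → ℝ} (h : IsLeastSquares Φ s y w) (hn : 0 < n)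
    (d : Fin k → ℝ) : ∑ i, ((Φ *ᵥ w) (s i) - y i) * (Φ *ᵥ d) (s i) = 0 := by
  have hn' : (0 : ℝ) < 1 / n := by positivity
  set p := ∑ i, ((Φ *ᵥ w) (s i) - y i) * (Φ *ᵥ d) (s i) with hp
  set q := ∑ i, (Φ *ᵥ d) (s i) ^ 2 with hq
  have hq0 : 0 ≤ q := Finset.sum_nonneg fun _ _ => sq_nonneg _
  have key (t : ℝ) : 0 ≤ 2 * t * p + t ^ 2 * q := by
    have h1 := le_of_mul_le_mul_left (h (w + t • d)) hn'
    have h2 : ∑ i, ((Φ *ᵥ (w + t • d)) (s i) - y i) ^ 2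
        = ∑ i, ((Φ *ᵥ w) (s i) - y i) ^ 2 + (2 * t * p + t ^ 2 * q) := by
      rw [hp, hq, Finset.mul_sum, Finset.mul_sum, ← Finset.sum_add_distrib,
        ← Finset.sum_add_distrib]
      refine Finset.sum_congr rfl fun i _ => ?_
      rw [Matrix.mulVec_add, Matrix.mulVec_smul, Pi.add_apply, Pi.smul_apply, smul_eq_mul]
      ring
    linarith
  -- Using `q + 1` in place of the minimizing denominator `q` avoids a separate case `q = 0`.
  have h3 := key (-p / (q + 1))
  have h4 : 2 * (-p / (q + 1)) * p + (-p / (q + 1)) ^ 2 * q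
      = -(p ^ 2 * (q + 2) / (q + 1) ^ 2) := by
    field_simp
    ring
  rw [h4] at h3
  by_contra hp0
  have : 0 < p ^ 2 * (q + 2) / (q + 1) ^ 2 := by
    have := sq_pos_of_ne_zero hp0
    positivity
  linarith

theorem toEuclideanLin_sqrtN_mul_apply {S k : ℕ} (ν : Measure (Fin S))
    (Φ : Matrix (Fin S) (Fin k) ℝ) (a : EuclideanSpace ℝ (Fin k)) (x : Fin S) :
    Matrix.toEuclideanLin (sqrtN ν * Φ) a x = √(ν.real {x}) * (Φ *ᵥ a.ofLp) x := by
  rw [Matrix.toLpLin_apply]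
  change ((sqrtN ν * Φ) *ᵥ a.ofLp) x = _
  rw [← Matrix.mulVec_mulVec, sqrtN, Matrix.mulVec_diagonal]

/-- The leverage of a state in the weighted design is at most `‖P_Φ e_x‖²` up to the smallest
mass. -/
theorem sum_sq_orthonormal_le {S k m : ℕ} {ν : Measure (Fin S)} (hν : ∀ i, 0 < ν.real {i})
    (Φ : Matrix (Fin S) (Fin k) ℝ) (e : Fin m → EuclideanSpace ℝ (Fin S)) (he : Orthonormal ℝ e)
    (hmem : ∀ j, e j ∈ LinearMap.range (Matrix.toEuclideanLin (sqrtN ν * Φ))) (x : Fin S) :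
    (∑ j, e j x ^ 2) / ν.real {x} ≤ effDim Φ / (minMass ν * S) := by
  have hS : 0 < S := x.pos
  have : Nonempty (Fin S) := ⟨x⟩
  have hSR : (0 : ℝ) < S := by exact_mod_cast hS
  have hmin : 0 < minMass ν := by
    obtain ⟨i, hi⟩ := exists_eq_ciInf_of_finite (f := fun i : Fin S => ν.real {i})
    rw [minMass, ← hi]; exact hν i
  have hminle (y : Fin S) : minMass ν ≤ ν.real {y} := ciInf_le (Set.finite_range _).bddBelow y
  set D := ∑ j, e j x ^ 2 with hD
  have hD0 : 0 ≤ D := Finset.sum_nonneg fun _ _ => sq_nonneg _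
  -- `d` is the projection of the `x`-th unit vector onto the span of the `e j`, so `‖d‖² = d x =
  -- D`. Writing `d = N^{1/2} f` with `f` in the column space of `Φ` gives `D² = ν_x (f x)²`, `|f x|
  -- ≤ ‖f‖ ‖P_Φ e_x‖` and `ν_min ‖f‖² ≤ D`; one factor `D` cancels.
  set d : EuclideanSpace ℝ (Fin S) := ∑ j, e j x • e j with hd
  have hdx : d x = D := by
    simp [hd, hD, sq]
  have hdn : ‖d‖ ^ 2 = D := by
    rw [← real_inner_self_eq_norm_sq, hd, he.inner_sum]
    simp [hD, sq]
  obtain ⟨a, ha⟩ : d ∈ LinearMap.range (Matrix.toEuclideanLin (sqrtN ν * Φ)) :=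
    Submodule.sum_mem _ fun j _ => Submodule.smul_mem _ _ (hmem j)
  set f : EuclideanSpace ℝ (Fin S) := Matrix.toEuclideanLin Φ a with hf
  have hfy (y : Fin S) : d y = √(ν.real {y}) * f y := by
    rw [← ha, toEuclideanLin_sqrtN_mul_apply, hf, Matrix.toLpLin_apply]
  have hfn : minMass ν * ‖f‖ ^ 2 ≤ D := by
    rw [← hdn, EuclideanSpace.norm_sq_eq, EuclideanSpace.norm_sq_eq, Finset.mul_sum]
    refine Finset.sum_le_sum fun y _ => ?_
    rw [hfy, norm_mul, mul_pow, Real.norm_eq_abs √_, sq_abs, Real.sq_sqrt (hν y).le]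
    gcongr
    exact hminle y
  have hfx : f x ^ 2 ≤ ‖f‖ ^ 2 * ‖colProj Φ (EuclideanSpace.single x 1)‖ ^ 2 := by
    have h1 : f x = inner ℝ f (colProj Φ (EuclideanSpace.single x 1)) := by
      have hfm : colProj Φ f = f := Submodule.starProjection_eq_self_iff.2 ⟨a, rfl⟩
      rw [colProj, ← Submodule.inner_starProjection_left_eq_right]
      change _ = inner ℝ (colProj Φ f) _
      rw [hfm, EuclideanSpace.inner_single_right]
      simp
    rw [h1, ← mul_pow]
    exact sq_le_sq.2 ((abs_real_inner_le_norm _ _).trans (le_abs_self _))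
  have hsup : ‖colProj Φ (EuclideanSpace.single x 1)‖ ^ 2 ≤ effDim Φ / S := by
    rw [effDim, mul_div_cancel_left₀ _ hSR.ne']
    exact le_ciSup (f := fun i : Fin S => ‖colProj Φ (EuclideanSpace.single i 1)‖ ^ 2)
      (Set.finite_range _).bddAbove x
  have hE0 : 0 ≤ effDim Φ / S := (sq_nonneg _).trans hsup
  have hDsq : D ^ 2 = ν.real {x} * f x ^ 2 := by
    rw [← hdx, hfy, mul_pow, Real.sq_sqrt (hν x).le]
  rw [show effDim Φ / (minMass ν * S) = effDim Φ / S / minMass ν by rw [div_div, mul_comm],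
    div_le_div_iff₀ (hν x) hmin]
  rcases hD0.eq_or_lt with h0 | h0
  · rw [← h0, zero_mul]; exact mul_nonneg hE0 (hν x).le
  · refine le_of_mul_le_mul_left ?_ h0
    calc D * (D * minMass ν) = minMass ν * D ^ 2 := by ring
      _ ≤ minMass ν * (ν.real {x} * (‖f‖ ^ 2 * (effDim Φ / S))) := by
          rw [hDsq]
          have := (hν x).le
          gcongr
          exact hfx.trans (by gcongr)
      _ = (minMass ν * ‖f‖ ^ 2) * (effDim Φ / S * ν.real {x}) := by ring
      _ ≤ D * (effDim Φ / S * ν.real {x}) := by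
          have := (hν x).le
          gcongr

theorem exists_orthonormal_of_finrank_eq {E : Type*} [NormedAddCommGroup E]
    [InnerProductSpace ℝ E] [FiniteDimensional ℝ E] {W : Submodule ℝ E} {k : ℕ}
    (hW : Module.finrank ℝ W = k) :
    ∃ e : Fin k → E, Orthonormal ℝ e ∧ (∀ j, e j ∈ W) ∧
      ∀ p ∈ W, ∃ θ : EuclideanSpace ℝ (Fin k), p = ∑ j, θ j • e j ∧ ‖θ‖ = ‖p‖ := by
  let u : OrthonormalBasis (Fin k) ℝ W := (stdOrthonormalBasis ℝ W).reindex (finCongr hW)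
  refine ⟨fun j => (u j : E), u.orthonormal.comp_linearIsometry W.subtypeₗᵢ, fun j => (u j).2,
    fun p hp => ⟨u.repr ⟨p, hp⟩, ?_, ?_⟩⟩
  · conv_lhs => rw [show p = ((⟨p, hp⟩ : W) : E) from rfl, ← u.sum_repr ⟨p, hp⟩]
    rw [Submodule.coe_sum]
    rfl
  · rw [LinearIsometryEquiv.norm_map]
    rfl

theorem finrank_range_sqrtN_mul {S k : ℕ} {ν : Measure (Fin S)} (hν : ∀ i, 0 < ν.real {i})
    (Φ : Matrix (Fin S) (Fin k) ℝ) :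
    Module.finrank ℝ (LinearMap.range (Matrix.toEuclideanLin (sqrtN ν * Φ))) = Φ.rank := by
  have h1 : (sqrtN ν * Φ).rank = Φ.rank := by
    rw [Matrix.rank_mul_eq_right_of_isUnit_det]
    rw [sqrtN, Matrix.det_diagonal, isUnit_iff_ne_zero]
    exact Finset.prod_ne_zero_iff.2 fun i _ => (Real.sqrt_pos.2 (hν i)).ne'
  rw [← h1, Matrix.rank_eq_finrank_range_toLin (sqrtN ν * Φ) (PiLp.basisFun 2 ℝ (Fin S))
    (PiLp.basisFun 2 ℝ (Fin k)), Matrix.toEuclideanLin, Matrix.toLpLin_eq_toLin]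

/-- Coordinates of the regression problem in an orthonormal basis of the weighted column space. -/
theorem exists_orthonormal_features {S k : ℕ} {ν : Measure (Fin S)} (hν : ∀ i, 0 < ν.real {i})
    (Φ : Matrix (Fin S) (Fin k) ℝ) (hΦ : Φ.rank = k) (V : Fin S → ℝ) :
    ∃ φ : Fin S → EuclideanSpace ℝ (Fin k),
      ∑ x, ν.real {x} • Matrix.vecMulVec (φ x).ofLp (φ x).ofLp = 1 ∧
      (∀ x, ‖φ x‖ ^ 2 ≤ effDim Φ / (minMass ν * S)) ∧
      (∀ j, ∃ a : Fin k → ℝ, ∀ x, φ x j = (Φ *ᵥ a) x) ∧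
      ∑ x, ν.real {x} • (invSqrtN ν *ᵥ (weightedResidual ν Φ V)) x • φ x = 0 ∧
      ∀ w : Fin k → ℝ, ∃ θ : EuclideanSpace ℝ (Fin k),
        (∀ x, inner ℝ (φ x) θ - (invSqrtN ν *ᵥ (weightedResidual ν Φ V)) x
          = (Φ *ᵥ w) x - V x) ∧
        ∑ x, ν.real {x} * ((Φ *ᵥ w) x - V x) ^ 2 = ‖weightedResidual ν Φ V‖ ^ 2 + ‖θ‖ ^ 2 := by
  set W := LinearMap.range (Matrix.toEuclideanLin (sqrtN ν * Φ)) with hW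
  have hs0 (x : Fin S) : 0 < √(ν.real {x}) := Real.sqrt_pos.2 (hν x)
  have hs2 (x : Fin S) (a b : ℝ) :
      ν.real {x} * ((√(ν.real {x}))⁻¹ * a * ((√(ν.real {x}))⁻¹ * b)) = a * b := by
    calc _ = ν.real {x} * (√(ν.real {x}) * √(ν.real {x}))⁻¹ * (a * b) := by rw [mul_inv]; ring
      _ = a * b := by rw [Real.mul_self_sqrt (hν x).le, mul_inv_cancel₀ (hν x).ne', one_mul]
  obtain ⟨e, heo, hem, hspan⟩ := exists_orthonormal_of_finrank_eq
    ((finrank_range_sqrtN_mul hν Φ).trans hΦ)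
  have hee (i j : Fin k) : ∑ x, e i x * e j x = if i = j then 1 else 0 := by
    have := orthonormal_iff_ite.1 heo i j
    rw [← this, PiLp.inner_apply]
    exact Finset.sum_congr rfl fun x _ => mul_comm _ _
  set v : EuclideanSpace ℝ (Fin S) := WithLp.toLp 2 (sqrtN ν *ᵥ V) with hv
  set r := weightedResidual ν Φ V with hr
  have hrv : r = v - W.starProjection v := rfl
  have hvx (x : Fin S) : v x = √(ν.real {x}) * V x := by
    simp [hv, sqrtN, Matrix.mulVec_diagonal]
  set g := invSqrtN ν *ᵥ r.ofLp with hg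
  have hgx (x : Fin S) : g x = (√(ν.real {x}))⁻¹ * r x := by
    rw [hg, invSqrtN, Matrix.mulVec_diagonal]
  set φ : Fin S → EuclideanSpace ℝ (Fin k) := fun x =>
    WithLp.toLp 2 fun j => (√(ν.real {x}))⁻¹ * e j x with hφ
  have hφx (x : Fin S) (j : Fin k) : φ x j = (√(ν.real {x}))⁻¹ * e j x := rfl
  refine ⟨φ, ?_, fun x => ?_, fun j => ?_, ?_, fun w => ?_⟩
  · ext i j
    rw [Matrix.sum_apply, Matrix.one_apply, ← hee i j]
    refine Finset.sum_congr rfl fun x _ => ?_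
    rw [Matrix.smul_apply, Matrix.vecMulVec_apply, hφx, hφx, smul_eq_mul, hs2]
  · refine le_trans (le_of_eq ?_) (sum_sq_orthonormal_le hν Φ e heo hem x)
    rw [EuclideanSpace.norm_sq_eq, Finset.sum_div]
    refine Finset.sum_congr rfl fun j _ => ?_
    rw [hφx, Real.norm_eq_abs, sq_abs, mul_pow, inv_pow, Real.sq_sqrt (hν x).le]
    ring
  · obtain ⟨a, ha⟩ := hem j
    refine ⟨a.ofLp, fun x => ?_⟩
    rw [hφx, ← ha, toEuclideanLin_sqrtN_mul_apply, inv_mul_cancel_left₀ (hs0 x).ne']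
  · ext j
    have h1 : inner ℝ r (e j) = 0 := W.starProjection_inner_eq_zero v (e j) (hem j)
    rw [PiLp.inner_apply] at h1
    rw [WithLp.ofLp_sum, Finset.sum_apply, PiLp.zero_apply, ← h1]
    refine Finset.sum_congr rfl fun x _ => ?_
    rw [PiLp.smul_apply, PiLp.smul_apply, hφx, hgx]
    simp only [smul_eq_mul, RCLike.inner_apply, conj_trivial]
    rw [hs2, mul_comm]
  -- `N^{1/2} (Φ w - V) = p - r` with `p` in the weighted column space and `r` orthogonal to it; `θ`
  -- is the coordinate vector of `p`, and the risk splits by Pythagoras.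
  · set p : EuclideanSpace ℝ (Fin S) :=
      Matrix.toEuclideanLin (sqrtN ν * Φ) (WithLp.toLp 2 w) - W.starProjection v with hp
    have hpW : p ∈ W := W.sub_mem ⟨_, rfl⟩ (W.starProjection_apply_mem v)
    obtain ⟨θ, hpsum, hθn⟩ := hspan p hpW
    have hpx (x : Fin S) : p x = √(ν.real {x}) * ((Φ *ᵥ w) x - V x) + r x := by
      rw [hp, hrv, PiLp.sub_apply, PiLp.sub_apply, hvx, toEuclideanLin_sqrtN_mul_apply]
      ring
    have hpr : inner ℝ r p = 0 := W.starProjection_inner_eq_zero v p hpW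
    refine ⟨θ, fun x => ?_, ?_⟩
    · have h1 : inner ℝ (φ x) θ = (√(ν.real {x}))⁻¹ * p x := by
        rw [hpsum, PiLp.inner_apply, WithLp.ofLp_sum, Finset.sum_apply, Finset.mul_sum]
        refine Finset.sum_congr rfl fun j _ => ?_
        rw [hφx, PiLp.smul_apply]
        simp only [smul_eq_mul, RCLike.inner_apply, conj_trivial]
        ring
      rw [h1, hpx, hgx, mul_add, inv_mul_cancel_left₀ (hs0 x).ne', add_sub_cancel_right]
    · have h2 : ‖p - r‖ ^ 2 = ‖r‖ ^ 2 + ‖p‖ ^ 2 := by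
        rw [norm_sub_sq_real, real_inner_comm, hpr]; ring
      rw [hθn, ← h2, EuclideanSpace.norm_sq_eq]
      refine Finset.sum_congr rfl fun x _ => ?_
      rw [PiLp.sub_apply, hpx, add_sub_cancel_right, norm_mul, mul_pow, Real.norm_eq_abs √_, sq_abs,
        Real.sq_sqrt (hν x).le, Real.norm_eq_abs, sq_abs]

/-! ### Transfer to the sample space and the excess risk bound. -/

/-- The failure event quantifies over all `θ`, so its measurability is not established. Its outer
measure is enough: the good event is the complement of a measurable hull. -/
theorem exists_measurableSet_of_measure_le {Ω : Type*} [MeasurableSpace Ω] (μ : Measure Ω)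
    [IsProbabilityMeasure μ] {δ : ℝ} (hδ : 0 ≤ δ) {s : Set Ω} (hs : μ s ≤ ENNReal.ofReal δ) :
    ∃ A : Set Ω, MeasurableSet A ∧ ENNReal.ofReal (1 - δ) ≤ μ A ∧ ∀ ω ∈ A, ω ∉ s := by
  refine ⟨(toMeasurable μ s)ᶜ, (measurableSet_toMeasurable μ s).compl, ?_,
    fun ω hω hs => hω (subset_toMeasurable μ s hs)⟩
  rw [prob_compl_eq_one_sub (measurableSet_toMeasurable μ s), measure_toMeasurable,
    ENNReal.ofReal_sub _ hδ, ENNReal.ofReal_one]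
  gcongr

theorem exists_measurableSet_excessRisk_le {S k n : ℕ} (Φ : Matrix (Fin S) (Fin k) ℝ)
    (hΦ : Φ.rank = k) (V : Fin S → ℝ) (σ : ℝ≥0) (ξ : Kernel (Fin S) ℝ) [IsMarkovKernel ξ]
    (hξ : ∀ x, HasSubgaussianMGF id (σ ^ 2) (ξ x)) (δ : ℝ) (hδ0 : 0 < δ) (hδ1 : δ < 1)
    {Ω : Type*} [MeasurableSpace Ω] (μ : Measure Ω) [IsProbabilityMeasure μ]
    (s : Fin n → Ω → Fin S) (η : Fin n → Ω → ℝ)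
    (hindep : iIndepFun (fun i ω => (s i ω, η i ω)) μ)
    (ν : Measure (Fin S)) [IsProbabilityMeasure ν] (hν : ∀ i, 0 < ν.real {i})
    (hlaw : ∀ i, HasLaw (fun ω => (s i ω, η i ω)) (ν ⊗ₘ ξ) μ)
    (hn : 8 * effDim Φ / (minMass ν * S) * Real.log (6 * k / δ) ≤ n) :
    ∃ A : Set Ω, MeasurableSet A ∧ ENNReal.ofReal (1 - δ) ≤ μ A ∧
      ∀ ω ∈ A, ∀ w : Fin k → ℝ,
        IsLeastSquares Φ (fun i => s i ω) (fun i => V (s i ω) + η i ω) w →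
        excessRisk ν V (Φ *ᵥ w) ≤
          ‖weightedResidual ν Φ V‖ ^ 2
          + 384 * (effDim Φ / (minMass ν * n * S)) * ‖weightedResidual ν Φ V‖ ^ 2
              * Real.log (3 / δ)
          + 48 * ((σ : ℝ) ^ 2 / n) * (2 * k + 3 * Real.log (3 / δ))
          + 64 / 3 * (effDim Φ / (minMass ν * (n : ℝ) ^ 2 * S))
              * supNorm (invSqrtN ν *ᵥ (weightedResidual ν Φ V)) ^ 2
              * Real.log (3 / δ) ^ 2 := by
  obtain ⟨φ, hφ1, hφL, hφΦ, hgφ, hcoord⟩ := exists_orthonormal_features hν Φ hΦ V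
  set g := invSqrtN ν *ᵥ (weightedResidual ν Φ V).ofLp with hg
  set r := weightedResidual ν Φ V with hr
  set L := effDim Φ / (minMass ν * S) with hL
  have hexc (f : Fin S → ℝ) : excessRisk ν V f = ∑ x, ν.real {x} * (f x - V x) ^ 2 := by
    rw [excessRisk, integral_fintype .of_finite]
    rfl
  have hL0 : 0 ≤ L := div_nonneg
    (mul_nonneg (Nat.cast_nonneg S) (Real.iSup_nonneg fun _ => sq_nonneg _))
    (mul_nonneg (Real.iInf_nonneg fun _ => measureReal_nonneg) (Nat.cast_nonneg S))
  have hc0 : 0 ≤ Real.log (3 / δ) := Real.log_nonneg (by rw [le_div_iff₀ hδ0]; linarith)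
  have hL1 : effDim Φ / (minMass ν * n * S) = L / n := by
    rw [hL, div_div]; ring
  have hL2 : effDim Φ / (minMass ν * (n : ℝ) ^ 2 * S) = L / (n : ℝ) ^ 2 := by
    rw [hL, div_div]; ring
  rw [hL1, hL2]
  -- For `k = 0` the sample-size condition is void (`Real.log 0 = 0`) and `n` may be `0`; but then
  -- `θ = 0` and the risk is exactly `‖r‖²`.
  rcases Nat.eq_zero_or_pos k with rfl | hk
  · refine ⟨Set.univ, .univ, ?_, fun ω _ w _ => ?_⟩
    · rw [measure_univ, ENNReal.ofReal_le_one]; linarith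
    · obtain ⟨θ, -, hθ⟩ := hcoord w
      rw [hexc, hθ, Subsingleton.elim θ 0, norm_zero]
      have h1 : 0 ≤ 384 * (L / n) * ‖r‖ ^ 2 * Real.log (3 / δ) := by positivity
      have h2 : 0 ≤ 48 * ((σ : ℝ) ^ 2 / n) * (2 * (0 : ℕ) + 3 * Real.log (3 / δ)) := by positivity
      have h3 : 0 ≤ 64 / 3 * (L / (n : ℝ) ^ 2) * supNorm g ^ 2 * Real.log (3 / δ) ^ 2 := by
        positivity
      linarith
  have hν1 : ∑ x, ν.real {x} = 1 := by
    rw [sum_measureReal_singleton]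
    simp
  -- The trace of the isotropy identity gives `k = E ‖φ‖² ≤ L`, hence the `1 ≤ L` that the Chernoff
  -- bound needs, and `0 < n`.
  have hkL : (k : ℝ) ≤ L := by
    have h1 := congrArg Matrix.trace hφ1
    rw [Matrix.trace_sum, Matrix.trace_one, Fintype.card_fin] at h1
    rw [← h1]
    calc ∑ x, (ν.real {x} • Matrix.vecMulVec (φ x).ofLp (φ x).ofLp).trace
        = ∑ x, ν.real {x} * ‖φ x‖ ^ 2 := by
          refine Finset.sum_congr rfl fun x _ => ?_
          rw [Matrix.trace_smul, Matrix.trace_vecMulVec, ← real_inner_self_eq_norm_sq,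
            EuclideanSpace.inner_eq_star_dotProduct, star_trivial, smul_eq_mul]
      _ ≤ ∑ x, ν.real {x} * L :=
          Finset.sum_le_sum fun x _ => mul_le_mul_of_nonneg_left (hφL x) (hν x).le
      _ = L := by rw [← Finset.sum_mul, hν1, one_mul]
  have hk1 : (1 : ℝ) ≤ k := by exact_mod_cast hk
  rw [mul_div_assoc] at hn
  have hnpos : 0 < n := by
    have : 0 < Real.log (6 * k / δ) := Real.log_pos (by rw [lt_div_iff₀ hδ0]; linarith)
    have h2 : 0 < 8 * L * Real.log (6 * k / δ) := by
      have : 0 < L := by linarith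
      positivity
    exact_mod_cast h2.trans_le hn
  have hbad := measure_pi_exists_normal_equation_le ν σ ξ hξ hδ0 hδ1 φ hφ1 (hk1.trans hkL) hφL hk
    hnpos hn g hgφ (norm_nonneg g) (fun x => norm_le_pi_norm g x)
  have hae (i : Fin n) : AEMeasurable (fun ω => (s i ω, η i ω)) μ := (hlaw i).aemeasurable
  have hmap : μ.map (fun ω i => (s i ω, η i ω)) = Measure.pi fun _ : Fin n => ν ⊗ₘ ξ := by
    rw [(iIndepFun_iff_map_fun_eq_pi_map hae).1 hindep]
    congr 1
    ext1 i
    exact (hlaw i).map_eq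
  rw [← hmap] at hbad
  obtain ⟨A, hA, hμA, hgood⟩ := exists_measurableSet_of_measure_le μ hδ0.le
    ((Measure.le_map_apply (aemeasurable_pi_iff.2 hae) _).trans hbad)
  refine ⟨A, hA, hμA, fun ω hω w hw => ?_⟩
  obtain ⟨θ, hθ1, hθ2⟩ := hcoord w
  have hρ : ∑ x, ν.real {x} * g x ^ 2 = ‖r‖ ^ 2 := by
    rw [EuclideanSpace.norm_sq_eq]
    refine Finset.sum_congr rfl fun x _ => ?_
    have h1 : g x = (√(ν.real {x}))⁻¹ * r x := by
      rw [hg, invSqrtN, Matrix.mulVec_diagonal]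
    rw [h1, mul_pow, inv_pow, Real.sq_sqrt (hν x).le, mul_inv_cancel_left₀ (hν x).ne',
      Real.norm_eq_abs, sq_abs]
  have hnot := hgood ω hω
  simp only [Set.mem_preimage, Set.mem_ofPred_eq, not_exists, not_and, not_lt, hρ] at hnot
  have hθ := hnot θ ?_
  · rw [hexc, hθ2]
    change ‖θ‖ ^ 2 ≤ _ + 64 / 3 * (L / (n : ℝ) ^ 2) * supNorm g ^ 2 * _ at hθ
    linarith
  · ext j
    obtain ⟨a, ha⟩ := hφΦ j
    have h1 := isLeastSquares_sum_residual_mul_eq_zero hw hnpos a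
    rw [WithLp.ofLp_sum, Finset.sum_apply, PiLp.zero_apply, ← h1]
    refine Finset.sum_congr rfl fun i _ => ?_
    rw [PiLp.smul_apply, smul_eq_mul, ha, hθ1]
    ring

/-! ### Population risk and the uniform distribution. -/

/-- From `1 + t m ≤ mgf t ≤ exp (c t² / 2)`, the gap between the outer terms is minimal at `t = 0`,
where its derivative is `-m`. -/
theorem HasSubgaussianMGF.integral_eq_zero_of_isProbabilityMeasure {Ω : Type*} [MeasurableSpace Ω]
    {μ : Measure Ω} [IsProbabilityMeasure μ] {X : Ω → ℝ} {c : ℝ≥0} (h : HasSubgaussianMGF X c μ) :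
    ∫ ω, X ω ∂μ = 0 := by
  have hint : Integrable X μ := (h.memLp 1).integrable (by simp)
  set m := ∫ ω, X ω ∂μ with hm
  have hmin : IsLocalMin (fun t : ℝ => Real.exp (c * t ^ 2 / 2) - 1 - t * m) 0 := by
    refine Filter.Eventually.of_forall fun t => ?_
    have h1 : 1 + t * m ≤ mgf X μ t := by
      have h2 : ∫ ω, (1 + t * X ω) ∂μ = 1 + t * m := by
        rw [integral_add (integrable_const _) (hint.const_mul t), integral_const_mul]
        simp [hm]
      rw [← h2]
      refine integral_mono ((integrable_const _).add (hint.const_mul t))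
        (h.integrable_exp_mul t) fun ω => ?_
      have := Real.add_one_le_exp (t * X ω)
      change 1 + t * X ω ≤ Real.exp (t * X ω)
      linarith
    have := h.mgf_le t
    simp
    linarith
  have hder : HasDerivAt (fun t : ℝ => Real.exp (c * t ^ 2 / 2) - 1 - t * m) (-m) 0 := by
    have h1 : HasDerivAt (fun t : ℝ => Real.exp (c * t ^ 2 / 2)) 0 0 := by
      refine ((((hasDerivAt_pow 2 (0 : ℝ)).const_mul (c : ℝ)).div_const 2).exp).congr_deriv ?_
      simp
    refine ((h1.sub_const 1).sub ((hasDerivAt_id (0 : ℝ)).mul_const m)).congr_deriv ?_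
    simp
  linarith [hmin.hasDerivAt_eq_zero hder]

theorem populationRisk_sub_populationRisk {S : ℕ} (ν : Measure (Fin S)) [IsProbabilityMeasure ν]
    {σ : ℝ≥0} (ξ : Kernel (Fin S) ℝ) [IsMarkovKernel ξ]
    (hξ : ∀ x, HasSubgaussianMGF id (σ ^ 2) (ξ x)) (V f : Fin S → ℝ) :
    populationRisk ν ξ V f - populationRisk ν ξ V V = excessRisk ν V f := by
  rw [populationRisk, populationRisk, excessRisk,
    ← integral_sub (Integrable.of_finite) (Integrable.of_finite)]
  refine integral_congr_ae (ae_of_all _ fun x => ?_)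
  have h1 : Integrable (fun e : ℝ => e) (ξ x) := ((hξ x).memLp 1).integrable (by simp)
  have h2 : Integrable (fun e : ℝ => e ^ 2) (ξ x) := ((hξ x).memLp 2).integrable_sq
  have h0 : ∫ e, e ∂(ξ x) = 0 :=
    HasSubgaussianMGF.integral_eq_zero_of_isProbabilityMeasure (hξ x)
  have h3 (a : ℝ) : ∫ e, (a - (V x + e)) ^ 2 ∂(ξ x)
      = (a - V x) ^ 2 + ∫ e, e ^ 2 ∂(ξ x) := by
    have h4 : (fun e : ℝ => (a - (V x + e)) ^ 2)
        = fun e => ((a - V x) ^ 2 - 2 * (a - V x) * e) + e ^ 2 := by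
      ext e; ring
    have h5 : Integrable (fun e : ℝ => (a - V x) ^ 2 - 2 * (a - V x) * e) (ξ x) :=
      (integrable_const _).sub (h1.const_mul _)
    rw [h4, integral_add h5 h2, integral_sub (integrable_const _) (h1.const_mul _),
      integral_const_mul, h0]
    simp
  simp only [h3]
  ring

theorem uniformStates_real_singleton {S : ℕ} (i : Fin S) :
    (uniformStates S).real {i} = 1 / S := by
  rw [uniformStates, measureReal_def, uniformOn_univ]
  simp

/-- For uniform `ν` the weight `N^{1/2}` is a nonzero scalar, so the column space and its projector
do not change. -/
theorem weightedResidual_uniformStates {S k : ℕ} (hS : 0 < S) (Φ : Matrix (Fin S) (Fin k) ℝ)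
    (V : Fin S → ℝ) :
    weightedResidual (uniformStates S) Φ V = √(1 / (S : ℝ)) • colProjPerp Φ V := by
  have hc : √(1 / (S : ℝ)) ≠ 0 := by positivity
  have h1 : sqrtN (uniformStates S) = √(1 / (S : ℝ)) • (1 : Matrix (Fin S) (Fin S) ℝ) := by
    rw [sqrtN, Matrix.smul_one_eq_diagonal]
    simp only [uniformStates_real_singleton]
  have h2 : LinearMap.range (Matrix.toEuclideanLin (√(1 / (S : ℝ)) • Φ))
      = LinearMap.range (Matrix.toEuclideanLin Φ) := by
    rw [map_smul, LinearMap.range_smul _ _ hc]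
  rw [weightedResidual, h1, Matrix.smul_mul, Matrix.one_mul, Matrix.smul_mulVec, Matrix.one_mulVec,
    colProjPerp, colProjPerp, colProj, colProj, smul_sub, ← map_smul, ← WithLp.toLp_smul]
  simp only [h2]

theorem norm_sq_colProjPerp_div {S k : ℕ} (Φ : Matrix (Fin S) (Fin k) ℝ) (V : Fin S → ℝ) :
    uniformNorm (colProjPerp Φ V) ^ 2 = 1 / S * ‖colProjPerp Φ V‖ ^ 2 := by
  rw [uniformNorm, Real.sq_sqrt (by positivity), EuclideanSpace.norm_sq_eq]
  simp only [Real.norm_eq_abs, sq_abs]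
/-- Part one: an arbitrary state distribution `ν` of full support. Part two: the uniform
distribution. `ξ x` is the law of the noise at state `x`; `HasSubgaussianMGF id (σ ^ 2) (ξ x)` says
`E exp (t e) ≤ exp (σ² t² / 2)` for all real `t`, which contains that the noise has mean zero. Noise
that is i.i.d. and independent of the states is the case of a constant `ξ`. -/
theorem mainTheorem1 {S k n : ℕ}
    (Φ : Matrix (Fin S) (Fin k) ℝ) (hΦ : Φ.rank = k) (V : Fin S → ℝ)
    (σ : ℝ≥0) (ξ : Kernel (Fin S) ℝ) [IsMarkovKernel ξ]
    (hξ : ∀ x, HasSubgaussianMGF id (σ ^ 2) (ξ x))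
    (δ : ℝ) (hδ0 : 0 < δ) (hδ1 : δ < 1)
    {Ω : Type*} [MeasurableSpace Ω] (μ : Measure Ω) [IsProbabilityMeasure μ]
    (s : Fin n → Ω → Fin S) (η : Fin n → Ω → ℝ)
    (hindep : iIndepFun (fun i ω => (s i ω, η i ω)) μ) :
    (∀ (ν : Measure (Fin S)) [IsProbabilityMeasure ν],
      (∀ i, 0 < ν.real {i}) →
      (∀ i, HasLaw (fun ω => (s i ω, η i ω)) (ν ⊗ₘ ξ) μ) →
      8 * effDim Φ / (minMass ν * S) * Real.log (6 * k / δ) ≤ n →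
      ∃ A : Set Ω, MeasurableSet A ∧ ENNReal.ofReal (1 - δ) ≤ μ A ∧
        ∀ ω ∈ A, ∀ w : Fin k → ℝ,
          IsLeastSquares Φ (fun i => s i ω) (fun i => V (s i ω) + η i ω) w →
          excessRisk ν V (Φ *ᵥ w) ≤
            ‖weightedResidual ν Φ V‖ ^ 2
            + 384 * (effDim Φ / (minMass ν * n * S)) * ‖weightedResidual ν Φ V‖ ^ 2
                * Real.log (3 / δ)
            + 48 * ((σ : ℝ) ^ 2 / n) * (2 * k + 3 * Real.log (3 / δ))
            + 64 / 3 * (effDim Φ / (minMass ν * (n : ℝ) ^ 2 * S))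
                * supNorm (invSqrtN ν *ᵥ (weightedResidual ν Φ V)) ^ 2
                * Real.log (3 / δ) ^ 2) ∧
    ((∀ i, HasLaw (fun ω => (s i ω, η i ω)) (uniformStates S ⊗ₘ ξ) μ) →
      8 * effDim Φ * Real.log (6 * k / δ) ≤ n →
      ∃ A : Set Ω, MeasurableSet A ∧ ENNReal.ofReal (1 - δ) ≤ μ A ∧
        ∀ ω ∈ A, ∀ w : Fin k → ℝ,
          IsLeastSquares Φ (fun i => s i ω) (fun i => V (s i ω) + η i ω) w →
          populationRisk (uniformStates S) ξ V (Φ *ᵥ w) - populationRisk (uniformStates S) ξ V V ≤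
            uniformNorm (colProjPerp Φ V) ^ 2
            + 384 * Real.log (3 / δ) * (effDim Φ / n) * uniformNorm (colProjPerp Φ V) ^ 2
            + 48 * (σ : ℝ) ^ 2 * ((2 * k + 3 * Real.log (3 / δ)) / n)
            + 64 / 3 * (effDim Φ / (n : ℝ) ^ 2) * supNorm (colProjPerp Φ V) ^ 2
                * Real.log (3 / δ) ^ 2) := by
  refine ⟨fun ν _ hν hlaw hn => exists_measurableSet_excessRisk_le Φ hΦ V σ ξ hξ δ hδ0 hδ1 μ s η
    hindep ν hν hlaw hn, fun hlaw hn => ?_⟩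
  have hc0 : 0 ≤ Real.log (3 / δ) := Real.log_nonneg (by rw [le_div_iff₀ hδ0]; linarith)
  -- With no states the uniform measure is zero rather than a probability measure, and both risks
  -- vanish.
  rcases Nat.eq_zero_or_pos S with rfl | hS
  · refine ⟨Set.univ, .univ, ?_, fun ω _ w _ => ?_⟩
    · rw [measure_univ, ENNReal.ofReal_le_one]; linarith
    · have h1 : effDim Φ = 0 := by simp [effDim]
      have h2 : uniformStates 0 = 0 := Measure.eq_zero_of_isEmpty _
      rw [h1, populationRisk, populationRisk, h2]
      simp only [integral_zero_measure, sub_zero]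
      positivity
  have hSR : (0 : ℝ) < S := by exact_mod_cast hS
  have : Nonempty (Fin S) := ⟨⟨0, hS⟩⟩
  have : IsProbabilityMeasure (uniformStates S) :=
    isProbabilityMeasure_uniformOn Set.finite_univ Set.univ_nonempty
  have hmin : minMass (uniformStates S) = 1 / S := by
    simp only [minMass, uniformStates_real_singleton, ciInf_const]
  have hd1 : effDim Φ / (minMass (uniformStates S) * S) = effDim Φ := by
    rw [hmin]; field_simp
  have hd2 (m : ℝ) : effDim Φ / (minMass (uniformStates S) * m * S) = effDim Φ / m := by
    rw [hmin, mul_right_comm, one_div_mul_cancel hSR.ne', one_mul]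
  obtain ⟨A, hA, hμA, hgood⟩ := exists_measurableSet_excessRisk_le Φ hΦ V σ ξ hξ δ hδ0 hδ1 μ s η
    hindep (uniformStates S) (fun i => by rw [uniformStates_real_singleton]; positivity) hlaw
    (by rw [mul_div_assoc, hd1]; exact hn)
  refine ⟨A, hA, hμA, fun ω hω w hw => ?_⟩
  rw [populationRisk_sub_populationRisk (uniformStates S) ξ hξ]
  refine (hgood ω hω w hw).trans (le_of_eq ?_)
  have hr : ‖weightedResidual (uniformStates S) Φ V‖ ^ 2 = uniformNorm (colProjPerp Φ V) ^ 2 := by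
    rw [weightedResidual_uniformStates hS, norm_smul, mul_pow, norm_sq_colProjPerp_div,
      Real.norm_eq_abs, sq_abs, Real.sq_sqrt (by positivity)]
  have hg : invSqrtN (uniformStates S) *ᵥ (weightedResidual (uniformStates S) Φ V).ofLp
      = (colProjPerp Φ V).ofLp := by
    have hc : √(1 / (S : ℝ)) ≠ 0 := by positivity
    ext x
    rw [invSqrtN, Matrix.mulVec_diagonal, weightedResidual_uniformStates hS,
      uniformStates_real_singleton, PiLp.smul_apply, smul_eq_mul, inv_mul_cancel_left₀ hc]
  rw [hr, hg, hd2, hd2]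
  ring
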